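/- For $n\ge 1$ let $B_n$ be the open unit ball of $\mathbb C^n$, $S_n=\partial B_n$, $\mathbb D=B_1$, $\mathbb T=S_1$, and let $m$ be the normalized Lebesgue measure on $\mathbb T$. Let $k\ge 1$ and $n_1,\dots,n_k\ge 1$, put $\mathcal D=B_{n_1}\times\dots\times B_{n_k}$ and $\partial\mathcal D=S_{n_1}\times\dots\times S_{n_k}$, and let $\Sigma$ be the normalized Lebesgue measure on $\partial\mathcal D$. Put $$C(z,w)=\prod_{j=1}^k\frac1{(1-\langle z_j,w_j\rangle)^{n_j}},\qquad P(z,\zeta)=\frac{C(z,\zeta)\,C(\zeta,z)}{C(z,z)}\qquad(z\in\mathcal D,\ \zeta\in\partial\mathcal D),$$ where $\langle\cdot,\cdot\rangle$ is the standard Hermitian inner product, linear in the first argument. For a function $f$ on $\mathcal D$, write $f(\zeta)=\lim_{r\to1-}f(r\zeta)$ for those $\zeta\in\partial\mathcal D$ at which this limit exists. Let $I:\mathcal D\to\mathbb D$ be an inner function, that is, a holomorphic function such that $I(\zeta)$ exists and $|I(\zeta)|=1$ for $\Sigma$-almost all $\zeta\in\partial\mathcal D$. Then for every $\alpha\in\mathbb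 T$ there is a unique finite positive Borel measure $\sigma_\alpha=\sigma_\alpha[I]$ on $\partial\mathcal D$ (the Clark measure) such that $$\int_{\partial\mathcal D}P(z,\zeta)\,d\sigma_\alpha(\zeta)=\mathrm{Re}\left(\frac{\alpha+I(z)}{\alpha-I(z)}\right)\qquad\text{for all } z\in\mathcal D.$$ Let $H^2$ be the space of holomorphic functions $f$ on $\mathcal D$ with $\sup_{0<r<1}\int_{\partial\mathcal D}|f(r\zeta)|^2\,d\Sigma(\zeta)<\infty$, identified, as usual, with the space of the boundary values $f(\zeta)$, a subspace of $L^2(\Sigma)$ with the scalar product $(f,g)_{H^2}=\int_{\partial\mathcal D}f\overline g\,d\Sigma$, and let $H^2\ominus IH^2$ be the orthogonal complement of $IH^2$ in $H^2$. Then for any $f,g\in H^2\ominus IH^2$ and any choice of representatives of their boundary values (functions on $\partial\mathcal D$ defined up to a $\Sigma$-null set), for $m$-almost all $\alpha\in\mathbb T$ the function $f\overline g$ is integrable with respect to $\sigma_\alpha$ and $$(f,g)_{H^2}=\int_{\partial\mathcal D}f\,\overline g\,d\sigma_\alpha .$$ -/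

import Mathlib

open MeasureTheory Set Filter Topology
open scoped ENNReal ComplexConjugate

noncomputable section

namespace ModelSpaces

/-- The normalized (probability) surface measure on the unit sphere of `V`. -/
def sphereMeasure (V : Type*) [NormedAddCommGroup V] [NormedSpace ℝ V] [MeasureSpace V] :
    Measure (Metric.sphere (0 : V) 1) :=
  ((volume : Measure V).toSphere univ)⁻¹ • (volume : Measure V).toSphere

/-- The unit circle `𝕋`, as a measurable space. -/
abbrev UnitCircle : Type := Metric.sphere (0 : ℂ) 1

/-- The normalized Lebesgue measure `m` on the unit circle. -/
def circleMeasure : Measure UnitCircle := sphereMeasure ℂ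

variable {k : ℕ} (n : Fin k → ℕ)

/-- The ambient space `ℂ^{n₁} × ⋯ × ℂ^{n_k}` (each factor with its Euclidean norm). -/
abbrev Ambient : Type := (j : Fin k) → EuclideanSpace ℂ (Fin (n j))

/-- The domain `𝒟 = B_{n₁} × ⋯ × B_{n_k}`. -/
def domain : Set (Ambient n) := {z | ∀ j, ‖z j‖ < 1}

/-- The distinguished boundary `∂𝒟 = S_{n₁} × ⋯ × S_{n_k}`. -/
abbrev DistBoundary : Type :=
  (j : Fin k) → Metric.sphere (0 : EuclideanSpace ℂ (Fin (n j))) 1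

/-- The normalized Lebesgue measure `Σ` on the distinguished boundary. -/
def boundaryMeasure : Measure (DistBoundary n) :=
  Measure.pi fun j => sphereMeasure (EuclideanSpace ℂ (Fin (n j)))

variable {n}

/-- The point `r ζ` of the ambient space. -/
def dilate (r : ℝ) (ζ : DistBoundary n) : Ambient n :=
  fun j => r • (ζ j : EuclideanSpace ℂ (Fin (n j)))

/-- A distinguished boundary point as a point of the ambient space. -/
def toAmbient (ζ : DistBoundary n) : Ambient n := fun j => ζ j

/-- The Cauchy kernel `C(z, w) = ∏ⱼ (1 - ⟨zⱼ, wⱼ⟩)^{-nⱼ}`. As `⟨·, ·⟩` is linear in the first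
argument while Mathlib's `inner` is linear in the second, `⟨zⱼ, wⱼ⟩ = inner ℂ (w j) (z j)`. -/
def cauchyKernel (z w : Ambient n) : ℂ :=
  ∏ j, 1 / (1 - inner ℂ (w j) (z j)) ^ n j

/-- The Poisson type kernel `P(z, ζ) = C(z, ζ) C(ζ, z) / C(z, z)`. -/
def poissonKernel (z : Ambient n) (ζ : DistBoundary n) : ℂ :=
  cauchyKernel z (toAmbient ζ) * cauchyKernel (toAmbient ζ) z / cauchyKernel z z

/-- `f(r ζ) → w` as `r → 1-`. -/
def HasRadialLimit (f : Ambient n → ℂ) (ζ : DistBoundary n) (w : ℂ) : Prop :=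
  Tendsto (fun r : ℝ => f (dilate r ζ)) (𝓝[<] 1) (𝓝 w)

/-- Inner functions: holomorphic maps `𝒟 → 𝔻` whose radial limits are unimodular almost everywhere
on the distinguished boundary. Functions on `𝒟` are represented by functions on the ambient space,
of which only the values on `𝒟` matter. -/
structure IsInner (I : Ambient n → ℂ) : Prop where
  holomorphic : DifferentiableOn ℂ I (domain n)
  norm_lt_one : ∀ z ∈ domain n, ‖I z‖ < 1
  unimodular : ∀ᵐ ζ ∂boundaryMeasure n, ∃ w : ℂ, HasRadialLimit I ζ w ∧ ‖w‖ = 1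

/-- `σ` is the Clark measure of `I` at `α`: a positive finite Borel measure on the distinguished
boundary with `P[σ](z) = Re ((α + I(z)) / (α - I(z)))` for all `z ∈ 𝒟`. -/
structure IsClarkMeasure (I : Ambient n → ℂ) (α : UnitCircle) (σ : Measure (DistBoundary n)) :
    Prop where
  finite : IsFiniteMeasure σ
  poisson : ∀ z ∈ domain n,
    ∫ ζ, poissonKernel z ζ ∂σ = ((((α : ℂ) + I z) / ((α : ℂ) - I z)).re : ℂ)

open Classical in
/-- The Clark measure `σ_α[I]` (with the value `0` if no measure has the defining property). -/
def clarkMeasure (I : Ambient n → ℂ) (α : UnitCircle) : Measure (DistBoundary n) :=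
  if h : ∃ σ, IsClarkMeasure I α σ then h.choose else 0

theorem mem_domain_dilate {r : ℝ} (hr : r ∈ Ioo (0 : ℝ) 1) (ζ : DistBoundary n) :
    dilate r ζ ∈ domain n := by
  intro j
  have h : ‖(ζ j : EuclideanSpace ℂ (Fin (n j)))‖ = 1 := by
    simp
  simp only [dilate, norm_smul, h, mul_one, Real.norm_eq_abs, abs_of_pos hr.1]
  exact hr.2

theorem continuous_comp_dilate {f : Ambient n → ℂ} (hf : DifferentiableOn ℂ f (domain n)) {r : ℝ}
    (hr : r ∈ Ioo (0 : ℝ) 1) : Continuous fun ζ : DistBoundary n => f (dilate r ζ) := by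
  refine hf.continuousOn.comp_continuous ?_ (mem_domain_dilate hr)
  unfold dilate
  fun_prop

/-- The square of the `H²` norm, `sup_{0<r<1} ∫ |f(rζ)|² dΣ(ζ)`, as an extended number. -/
def hardyNormSq (f : Ambient n → ℂ) : ℝ≥0∞ :=
  ⨆ r ∈ Ioo (0 : ℝ) 1, ∫⁻ ζ, ‖f (dilate r ζ)‖ₑ ^ 2 ∂boundaryMeasure n

theorem hardyNormSq_add_le {f g : Ambient n → ℂ} (hf : DifferentiableOn ℂ f (domain n)) :
    hardyNormSq (f + g) ≤ 2 * hardyNormSq f + 2 * hardyNormSq g := by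
  refine iSup₂_le fun r hr => ?_
  have key : ∀ a b : ℂ, ‖a + b‖ₑ ^ 2 ≤ 2 * ‖a‖ₑ ^ 2 + 2 * ‖b‖ₑ ^ 2 := by
    intro a b
    have h : ‖a + b‖₊ ^ 2 ≤ 2 * ‖a‖₊ ^ 2 + 2 * ‖b‖₊ ^ 2 := by
      rw [← NNReal.coe_le_coe]
      push_cast
      nlinarith [norm_add_le a b, norm_nonneg (a + b), sq_nonneg (‖a‖ - ‖b‖), norm_nonneg a,
        norm_nonneg b]
    simp only [enorm_eq_nnnorm]
    exact_mod_cast h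
  have hm : Measurable fun ζ : DistBoundary n => 2 * ‖f (dilate r ζ)‖ₑ ^ 2 :=
    ((continuous_comp_dilate hf hr).measurable.enorm.pow_const 2).const_mul 2
  calc ∫⁻ ζ, ‖(f + g) (dilate r ζ)‖ₑ ^ 2 ∂boundaryMeasure n
      ≤ ∫⁻ ζ, (2 * ‖f (dilate r ζ)‖ₑ ^ 2 + 2 * ‖g (dilate r ζ)‖ₑ ^ 2) ∂boundaryMeasure n :=
        lintegral_mono fun ζ => key _ _
    _ = 2 * ∫⁻ ζ, ‖f (dilate r ζ)‖ₑ ^ 2 ∂boundaryMeasure n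
        + 2 * ∫⁻ ζ, ‖g (dilate r ζ)‖ₑ ^ 2 ∂boundaryMeasure n := by
        rw [lintegral_add_left hm, lintegral_const_mul' _ _ (by simp),
          lintegral_const_mul' _ _ (by simp)]
    _ ≤ 2 * hardyNormSq f + 2 * hardyNormSq g := by
        gcongr
        · exact le_iSup₂_of_le (f := fun r (_ : r ∈ Ioo (0 : ℝ) 1) =>
            ∫⁻ ζ, ‖f (dilate r ζ)‖ₑ ^ 2 ∂boundaryMeasure n) r hr le_rfl
        · exact le_iSup₂_of_le (f := fun r (_ : r ∈ Ioo (0 : ℝ) 1) =>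
            ∫⁻ ζ, ‖g (dilate r ζ)‖ₑ ^ 2 ∂boundaryMeasure n) r hr le_rfl

theorem hardyNormSq_smul_le (c : ℂ) (f : Ambient n → ℂ) :
    hardyNormSq (c • f) ≤ ‖c‖ₑ ^ 2 * hardyNormSq f := by
  refine iSup₂_le fun r hr => ?_
  have h : ∫⁻ ζ, ‖(c • f) (dilate r ζ)‖ₑ ^ 2 ∂boundaryMeasure n
      = ‖c‖ₑ ^ 2 * ∫⁻ ζ, ‖f (dilate r ζ)‖ₑ ^ 2 ∂boundaryMeasure n := by
    rw [← lintegral_const_mul' _ _ (by simp)]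
    simp [mul_pow]
  rw [h]
  gcongr
  exact le_iSup₂_of_le (f := fun r (_ : r ∈ Ioo (0 : ℝ) 1) =>
    ∫⁻ ζ, ‖f (dilate r ζ)‖ₑ ^ 2 ∂boundaryMeasure n) r hr le_rfl

variable (n)

/-- The Hardy space `H²(𝒟)` of holomorphic functions. -/
def hardySpace : Submodule ℂ (Ambient n → ℂ) where
  carrier := {f | DifferentiableOn ℂ f (domain n) ∧ hardyNormSq f < ∞}
  add_mem' := fun {f g} hf hg => ⟨hf.1.add hg.1,
    (hardyNormSq_add_le hf.1).trans_lt (ENNReal.add_lt_top.2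
      ⟨ENNReal.mul_lt_top (by simp) hf.2, ENNReal.mul_lt_top (by simp) hg.2⟩)⟩
  zero_mem' := ⟨differentiableOn_const 0, by simp [hardyNormSq]⟩
  smul_mem' := fun c f hf => ⟨hf.1.const_smul c,
    (hardyNormSq_smul_le c f).trans_lt (ENNReal.mul_lt_top (by simp) hf.2)⟩

variable {n}

/-- The elements of `L²(Σ)` that are the boundary values (radial limits almost everywhere) of the
functions in `W`. -/
def boundaryValues (W : Submodule ℂ (Ambient n → ℂ)) :
    Submodule ℂ (Lp ℂ 2 (boundaryMeasure n)) where
  carrier := {F | ∃ f ∈ W, ∀ᵐ ζ ∂boundaryMeasure n, HasRadialLimit f ζ (F ζ)}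
  add_mem' := by
    rintro F G ⟨f, hf, hF⟩ ⟨g, hg, hG⟩
    refine ⟨f + g, W.add_mem hf hg, ?_⟩
    filter_upwards [hF, hG, Lp.coeFn_add F G] with ζ h1 h2 h3
    rw [h3]
    exact Tendsto.add h1 h2
  zero_mem' := by
    refine ⟨0, W.zero_mem, ?_⟩
    filter_upwards [Lp.coeFn_zero ℂ 2 (boundaryMeasure n)] with ζ h
    rw [h]
    exact tendsto_const_nhds
  smul_mem' := by
    rintro c F ⟨f, hf, hF⟩
    refine ⟨c • f, W.smul_mem c hf, ?_⟩
    filter_upwards [hF, Lp.coeFn_smul c F] with ζ h1 h2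
    rw [h2]
    exact Tendsto.const_smul h1 c

/-- The space `I H²(𝒟)` of holomorphic functions. -/
def innerMulHardySpace (I : Ambient n → ℂ) : Submodule ℂ (Ambient n → ℂ) :=
  (hardySpace n).map (LinearMap.mulLeft ℂ I)

/-- The large model space `H² ⊖ I H²`, where `H²` and `I H²` are identified with spaces of boundary
values in `L²(Σ)`. -/
def largeModelSpace (I : Ambient n → ℂ) : Submodule ℂ (Lp ℂ 2 (boundaryMeasure n)) :=
  boundaryValues (hardySpace n) ⊓ (boundaryValues (innerMulHardySpace I))ᗮ

end ModelSpaces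

end

noncomputable section

namespace ModelSpaces

/-! ### Normalized sphere measure: invariance under isometries and an ellipsoid integral. -/

section Sphere

open Module
open scoped Pointwise

variable {V : Type*} [NormedAddCommGroup V] [InnerProductSpace ℂ V] [FiniteDimensional ℂ V]
  [MeasureSpace V] [BorelSpace V] [(volume : Measure V).IsAddHaarMeasure]

/-! Put Φ(α) = ∫ f ḡ dσ_α. The theorem says that Φ has no Fourier coefficient besides the zeroth
one. The Poisson kernel of the disc reproduces monomials: ∫ α^m Re((α + w)/(α - w)) dm(α) = w^m for
|w| < 1 and m ≥ 0. Taking w = I(rη), integrating in η and letting r → 1 gives ∫ α^m (∫ φ dσ_α) dm(α)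
= ∫ I^m φ dΣ, first for continuous φ and then, by density, for all φ in L¹(Σ)
(`IsInner.integral_pow_mul_integral_clarkMeasure`). The case m = 0, proved beforehand as
`IsInner.bind_clarkKernel`, is the disintegration of Σ into the Clark measures. It shows that φ is
σ_α-integrable for almost all α and that a Σ-null set is σ_α-null for almost all α, so
representatives do not matter.

For φ = f ḡ and m ≥ 1 the right-hand side is (I^m f, g), which is 0 because I^m f lies in I H² and g
is orthogonal to it. Exchanging f and g and conjugating removes the negative coefficients. Hence Φ
is almost everywhere equal to its mean, which is (f, g).

Underneath lies the Poisson kernel of the product of balls. It reproduces holomorphic functions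
(`integral_realPoisson_mul`) and is an approximate identity; weak compactness then gives existence
of σ_α, and density of Poisson integrals gives uniqueness. The reproducing property comes from the
Cauchy formula. That formula reduces in one ball to the moments of |⟨ζ, e⟩|² on the sphere, which
are read off from the volume of an ellipsoid, and passes to products one coordinate at a time. -/

theorem volume_preimage_linearIsometry (e : V →ₗᵢ[ℝ] V) (s : Set V) :
    volume (e ⁻¹' s) = volume s := by
  have : FiniteDimensional ℝ V := FiniteDimensional.complexToReal V
  have hdet : LinearMap.det e.toLinearMap ≠ 0 := by
    have h1 := LinearMap.injective_iff_surjective.1 e.injective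
    exact (LinearEquiv.isUnit_det' (LinearEquiv.ofBijective e.toLinearMap ⟨e.injective, h1⟩)).ne_zero
  have key := fun s => Measure.addHaar_preimage_linearMap (volume : Measure V) hdet s
  -- The unit ball is its own preimage and has finite nonzero volume, which forces the determinant
  -- factor to be 1.
  have hb := key (Metric.ball 0 1)
  have hpre : e.toLinearMap ⁻¹' Metric.ball 0 1 = Metric.ball 0 1 := by
    ext x; simp
  rw [hpre] at hb
  have hpos : volume (Metric.ball (0 : V) 1) ≠ 0 := (Metric.measure_ball_pos _ _ one_pos).ne'
  have hfin : volume (Metric.ball (0 : V) 1) ≠ ∞ := measure_ball_lt_top.ne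
  have h1 : ENNReal.ofReal |(LinearMap.det e.toLinearMap)⁻¹| = 1 :=
    (ENNReal.mul_left_inj hpos hfin).1 (by rw [← hb, one_mul])
  have h2 := key s
  rw [h1, one_mul] at h2
  exact h2

/-- The action of a linear isometry on the unit sphere. -/
def sphereMap (e : V →ₗᵢ[ℝ] V) (ζ : Metric.sphere (0 : V) 1) : Metric.sphere (0 : V) 1 :=
  ⟨e ζ, by simp⟩

omit [FiniteDimensional ℂ V] [MeasureSpace V] [BorelSpace V]
  [(volume : Measure V).IsAddHaarMeasure] in
theorem continuous_sphereMap (e : V →ₗᵢ[ℝ] V) : Continuous (sphereMap e) :=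
  Continuous.subtype_mk (e.continuous.comp continuous_subtype_val) _

/-- `toSphere` measures a set by the volume of the cone over it, up to the dimension factor, and a
linear isometry carries cones to cones of the same volume. -/
theorem measurePreserving_sphereMap (e : V →ₗᵢ[ℝ] V) :
    MeasurePreserving (sphereMap e) (sphereMeasure V) (sphereMeasure V) := by
  have hm : Measurable (sphereMap e) := (continuous_sphereMap e).measurable
  suffices MeasurePreserving (sphereMap e) (volume : Measure V).toSphere
      (volume : Measure V).toSphere from this.smul_measure _
  refine ⟨hm, ?_⟩
  have : FiniteDimensional ℝ V := FiniteDimensional.complexToReal V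
  have hsurj := (LinearMap.injective_iff_surjective (f := e.toLinearMap)).1 e.injective
  ext s hs
  rw [Measure.map_apply hm hs, Measure.toSphere_apply' _ hs, Measure.toSphere_apply' _ (hm hs),
    ← volume_preimage_linearIsometry e (Ioo (0 : ℝ) 1 • (Subtype.val '' s))]
  congr 2
  ext x
  simp only [Set.mem_smul, mem_image, mem_preimage, Subtype.exists, exists_and_right]
  constructor
  · rintro ⟨r, hr, _, ⟨y, ⟨hy, hys⟩, rfl⟩, hx⟩
    refine ⟨r, hr, e y, ⟨e y, ⟨by simpa using hy, hys⟩, rfl⟩, ?_⟩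
    rw [← hx]; simp
  · rintro ⟨r, hr, _, ⟨y, ⟨hy, hys⟩, rfl⟩, hx⟩
    obtain ⟨z, rfl⟩ := hsurj y
    have hz : z ∈ Metric.sphere (0 : V) 1 := by simpa using hy
    refine ⟨r, hr, z, ⟨z, ⟨hz, hys⟩, rfl⟩, ?_⟩
    exact e.injective (by simpa using hx)

instance [Nontrivial V] : IsProbabilityMeasure (sphereMeasure V) := by
  have : FiniteDimensional ℝ V := FiniteDimensional.complexToReal V
  refine ⟨?_⟩
  rw [sphereMeasure, Measure.smul_apply, smul_eq_mul]
  refine ENNReal.inv_mul_cancel ?_ (measure_ne_top _ _)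
  rw [Ne, Measure.measure_univ_eq_zero]
  exact Measure.toSphere_ne_zero _

/-- The function `ζ ↦ (1 - y |⟨ζ, e⟩|²)^{-n}` integrates to `1 / (1 - y)`: compare the volume of an
ellipsoid in polar coordinates with the one given by the determinant. -/
theorem integral_sphere_inv_one_sub_pow [Nontrivial V] {e : V} (he : ‖e‖ = 1) {y : ℝ} (hy1 : y < 1) :
    ∫ ζ : Metric.sphere (0 : V) 1, ((1 - y * ‖inner ℂ e (ζ : V)‖ ^ 2) ^ finrank ℂ V)⁻¹
      ∂sphereMeasure V = (1 - y)⁻¹ := by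
  have : FiniteDimensional ℝ V := FiniteDimensional.complexToReal V
  set μ : Measure V := volume
  set n := finrank ℂ V with hn
  have hdim : finrank ℝ V = 2 * n := finrank_real_of_complex V
  have hn0 : 0 < n := finrank_pos
  have hale : ∀ w : V, ‖inner ℂ e w‖ ≤ ‖w‖ := fun w => by
    simpa [he] using norm_inner_le_norm (𝕜 := ℂ) e w
  -- the linear map with `‖T w‖² = ‖w‖² - y |⟨w, e⟩|²`
  set s := Real.sqrt (1 - y) with hs
  have hs2 : s ^ 2 = 1 - y := Real.sq_sqrt (by linarith)
  have hspos : 0 < s := Real.sqrt_pos.2 (by linarith)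
  let T : V →ₗ[ℂ] V := LinearMap.transvection (innerSL ℂ e).toLinearMap (((s - 1 : ℝ) : ℂ) • e)
  have hT : ∀ w, T w = w + ((s - 1 : ℝ) : ℂ) • (inner ℂ e w) • e := by
    intro w
    simp [T, LinearMap.transvection, smul_smul, mul_comm]
  have hTn : ∀ w, ‖T w‖ ^ 2 = ‖w‖ ^ 2 - y * ‖inner ℂ e w‖ ^ 2 := by
    intro w
    rw [hT, @norm_add_sq ℂ, smul_smul, inner_smul_right, norm_smul, he, ← inner_conj_symm w e,
      mul_assoc, Complex.mul_conj, ← Complex.ofReal_mul, norm_mul, Complex.norm_real,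
      Complex.normSq_eq_norm_sq]
    simp only [RCLike.re_eq_complex_re, Complex.ofReal_re, Real.norm_eq_abs, mul_one, mul_pow,
      sq_abs]
    nlinarith
  have hdet : LinearMap.det (T.restrictScalars ℝ) = 1 - y := by
    rw [LinearMap.det_restrictScalars, Algebra.norm_complex_apply]
    have : LinearMap.det T = (s : ℂ) := by
      simp only [T]
      rw [LinearMap.transvection.det]
      simp [inner_self_eq_norm_sq_to_K, he]
    rw [this, Complex.normSq_ofReal, ← sq, hs2]
  have hvol : μ ((T.restrictScalars ℝ) ⁻¹' Metric.ball 0 1)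
      = ENNReal.ofReal (1 - y)⁻¹ * μ (Metric.ball 0 1) := by
    rw [Measure.addHaar_preimage_linearMap _ (by rw [hdet]; linarith), hdet, abs_of_pos]
    exact inv_pos.2 (by linarith)
  -- polar coordinates
  let q : Metric.sphere (0 : V) 1 → ℝ := fun ζ => 1 - y * ‖inner ℂ e (ζ : V)‖ ^ 2
  have hq : ∀ ζ, 0 < q ζ := by
    intro ζ
    have h1 : ‖inner ℂ e (ζ : V)‖ ≤ 1 := by simpa using hale ζ
    have h2 : ‖inner ℂ e (ζ : V)‖ ^ 2 ≤ 1 := pow_le_one₀ (norm_nonneg _) h1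
    have h3 := sq_nonneg ‖inner ℂ e (ζ : V)‖
    simp only [q]
    rcases le_total y 0 with h | h <;> nlinarith
  have hqc : Continuous q := by fun_prop
  have hpolar : μ ((T.restrictScalars ℝ) ⁻¹' Metric.ball 0 1)
      = ∫⁻ ζ, ENNReal.ofReal (((q ζ) ^ n)⁻¹ / (2 * n)) ∂μ.toSphere := by
    set B : Set V := (T.restrictScalars ℝ) ⁻¹' Metric.ball 0 1
    have hB : IsOpen B := Metric.isOpen_ball.preimage
      (LinearMap.continuous_of_finiteDimensional (T.restrictScalars ℝ))
    -- Since ‖T(tζ)‖² = t² q(ζ), the ellipsoid in polar coordinates is the region t < q(ζ)^(-1/2);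
    -- integrating t^(2n-1) over it gives q(ζ)^(-n)/(2n).
    let C : Set (Metric.sphere (0 : V) 1 × Ioi (0 : ℝ)) := {p | (p.2 : ℝ) < (Real.sqrt (q p.1))⁻¹}
    have hC : MeasurableSet C := by
      apply IsOpen.measurableSet
      refine isOpen_lt (by fun_prop) (Continuous.inv₀ (by fun_prop) fun p => ?_)
      exact (Real.sqrt_pos.2 (hq _)).ne'
    have hBC : ((↑) : ({0}ᶜ : Set V) → V) ⁻¹' B = homeomorphUnitSphereProd V ⁻¹' C := by
      ext x
      have hx : ‖(x : V)‖ ≠ 0 := norm_ne_zero_iff.2 x.2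
      have hx' : 0 < ‖(x : V)‖ := norm_pos_iff.2 x.2
      simp only [B, C, mem_preimage, Metric.mem_ball, dist_zero_right, mem_ofPred_eq,
        LinearMap.coe_restrictScalars, homeomorphUnitSphereProd_apply_snd_coe]
      rw [lt_inv_comm₀ hx' (Real.sqrt_pos.2 (hq _)), Real.sqrt_lt' (inv_pos.2 hx'),
        ← sq_lt_one_iff₀ (norm_nonneg _), hTn]
      simp only [q, homeomorphUnitSphereProd_apply_fst_coe]
      rw [← Complex.coe_smul, inner_smul_right, norm_mul, Complex.norm_real, mul_pow]
      simp only [norm_inv, norm_norm]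
      rw [← mul_lt_mul_iff_of_pos_left (pow_pos hx' 2)]
      field_simp
    have h0 : μ B = (μ.comap ((↑) : ({0}ᶜ : Set V) → V)) ((↑) ⁻¹' B) := by
      have : Nontrivial V := inferInstance
      rw [comap_subtype_coe_apply (measurableSet_singleton _).compl, Subtype.image_preimage_coe,
        ← Set.sdiff_eq_compl_inter, measure_sdiff_null (measure_singleton _)]
    rw [h0, hBC, (Measure.measurePreserving_homeomorphUnitSphereProd μ).measure_preimage
      hC.nullMeasurableSet, Measure.prod_apply hC]
    congr with ζ
    have hr : 0 < (Real.sqrt (q ζ))⁻¹ := inv_pos.2 (Real.sqrt_pos.2 (hq ζ))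
    have : Prod.mk ζ ⁻¹' C = Iio (⟨(Real.sqrt (q ζ))⁻¹, hr⟩ : Ioi (0 : ℝ)) := by
      ext t; rfl
    rw [this, Measure.volumeIoiPow_apply_Iio]
    congr 1
    have h3 : finrank ℝ V - 1 + 1 = 2 * n := by omega
    have h4 : ((finrank ℝ V - 1 : ℕ) : ℝ) + 1 = 2 * n := by exact_mod_cast h3
    rw [h4, h3, pow_mul, inv_pow, Real.sq_sqrt (hq ζ).le, inv_pow]
  have hint : Integrable (fun ζ => ((q ζ) ^ n)⁻¹) μ.toSphere :=
    (((hqc.pow n).inv₀ fun ζ => (pow_pos (hq ζ) n).ne').integrable_of_hasCompactSupport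
      (HasCompactSupport.of_compactSpace _))
  have hball : μ (Metric.ball 0 1) ≠ 0 := (Metric.measure_ball_pos _ _ one_pos).ne'
  have hballt : μ (Metric.ball 0 1) ≠ ∞ := measure_ball_lt_top.ne
  have hreal : ∫ ζ, ((q ζ) ^ n)⁻¹ / (2 * n) ∂μ.toSphere = (1 - y)⁻¹ * μ.real (Metric.ball 0 1) := by
    rw [integral_eq_lintegral_of_nonneg_ae (ae_of_all _ fun ζ => by have := hq ζ; positivity)
      (hint.div_const _).aestronglyMeasurable, ← hpolar, hvol, ENNReal.toReal_mul,
      ENNReal.toReal_ofReal (inv_nonneg.2 (by linarith))]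
    rfl
  rw [integral_div] at hreal
  change ∫ ζ, ((q ζ) ^ n)⁻¹ ∂sphereMeasure V = _
  rw [sphereMeasure, integral_smul_measure, Measure.toSphere_apply_univ, hdim]
  have hbr : μ.real (Metric.ball (0 : V) 1) ≠ 0 := by
    simp [measureReal_def, ENNReal.toReal_eq_zero_iff, hball, hballt]
  have hn0' : (n : ℝ) ≠ 0 := by exact_mod_cast hn0.ne'
  rw [div_eq_iff (by positivity)] at hreal
  rw [hreal, ENNReal.toReal_inv, ENNReal.toReal_mul, smul_eq_mul, ← measureReal_def]
  have h5 : (((2 * n : ℕ) : ℝ≥0∞)).toReal = 2 * n := by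
    rw [ENNReal.toReal_natCast]; push_cast; ring
  rw [h5]
  change (2 * (n : ℝ) * μ.real (Metric.ball 0 1))⁻¹ * _ = _
  field_simp

end Sphere

/-! ### Moments of ⟨ζ, e⟩ on the sphere and reduction to a complex line. -/

section Sphere

open Module
open scoped Pointwise

variable {V : Type*} [NormedAddCommGroup V] [InnerProductSpace ℂ V] [FiniteDimensional ℂ V]
  [MeasureSpace V] [BorelSpace V] [(volume : Measure V).IsAddHaarMeasure]

theorem integrable_of_continuous_of_compactSpace {X E : Type*} [TopologicalSpace X] [CompactSpace X]
    [MeasurableSpace X] [OpensMeasurableSpace X] [NormedAddCommGroup E]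
    {μ : Measure X} [IsFiniteMeasure μ] {f : X → E} (hf : Continuous f) : Integrable f μ :=
  hf.integrable_of_hasCompactSupport (HasCompactSupport.of_compactSpace _)

omit [FiniteDimensional ℂ V] [MeasureSpace V] [BorelSpace V]
  [(volume : Measure V).IsAddHaarMeasure] in
theorem norm_inner_sphere_le_one {e : V} (he : ‖e‖ = 1) (ζ : Metric.sphere (0 : V) 1) :
    ‖inner ℂ e (ζ : V)‖ ≤ 1 := by
  simpa [he] using norm_inner_le_norm (𝕜 := ℂ) e (ζ : V)

/-- `⟨ζ, e⟩^j` and `⟨ζ, e⟩^m` are orthogonal on the sphere for `j ≠ m`. -/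
theorem integral_inner_pow_mul_conj_pow_eq_zero (e : V) {j m : ℕ} (hjm : j ≠ m) :
    ∫ ζ : Metric.sphere (0 : V) 1, inner ℂ e (ζ : V) ^ j * conj (inner ℂ e (ζ : V)) ^ m
      ∂sphereMeasure V = 0 := by
  have hne : ((j : ℝ) - m) ≠ 0 := sub_ne_zero.2 (by exact_mod_cast hjm)
  -- The angle is chosen so that rotation by c multiplies the integrand by c^(j-m) = -1; invariance
  -- of the measure then makes the integral its own negative.
  set t : ℝ := Real.pi / (j - m) with ht
  set c : ℂ := Complex.exp (t * Complex.I) with hc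
  have hcn : ‖c‖ = 1 := Complex.norm_exp_ofReal_mul_I t
  have hcc : c ^ j * conj c ^ m = -1 := by
    rw [hc, ← Complex.exp_conj, ← Complex.exp_nat_mul, ← Complex.exp_nat_mul, ← Complex.exp_add,
      ← Complex.exp_pi_mul_I]
    congr 1
    have h : (Real.pi : ℂ) = t * ((j : ℂ) - m) := by
      have : Real.pi = t * (j - m) := by rw [ht]; field_simp
      rw [this]; push_cast; ring
    rw [h]
    simp
    ring
  let U : V →ₗᵢ[ℝ] V :=
    { toLinearMap := (c • (LinearMap.id : V →ₗ[ℂ] V)).restrictScalars ℝ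
      norm_map' := fun x => by simp [norm_smul, hcn] }
  set F : Metric.sphere (0 : V) 1 → ℂ :=
    fun ζ => inner ℂ e (ζ : V) ^ j * conj (inner ℂ e (ζ : V)) ^ m with hF
  have hFc : Continuous F := by fun_prop
  have h1 : ∫ ζ, F (sphereMap U ζ) ∂sphereMeasure V = ∫ ζ, F ζ ∂sphereMeasure V := by
    conv_rhs => rw [← (measurePreserving_sphereMap U).map_eq]
    rw [integral_map (continuous_sphereMap U).aemeasurable hFc.aestronglyMeasurable]
  have h2 : ∀ ζ, F (sphereMap U ζ) = -F ζ := by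
    intro ζ
    have : ((sphereMap U ζ : Metric.sphere (0 : V) 1) : V) = c • (ζ : V) := rfl
    simp only [hF, this, inner_smul_right, mul_pow, map_mul]
    linear_combination (inner ℂ e (ζ : V) ^ j * conj (inner ℂ e (ζ : V)) ^ m) * hcc
  simp only [h2, integral_neg] at h1
  exact self_eq_neg.1 h1.symm

/-- The moments of `|⟨ζ, e⟩|²` on the sphere. -/
theorem choose_mul_integral_norm_inner_pow [Nontrivial V] {e : V} (he : ‖e‖ = 1) (m : ℕ) :
    ((m + (finrank ℂ V - 1)).choose (finrank ℂ V - 1) : ℝ) *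
      ∫ ζ : Metric.sphere (0 : V) 1, (‖inner ℂ e (ζ : V)‖ ^ 2) ^ m ∂sphereMeasure V = 1 := by
  obtain ⟨d, hd⟩ : ∃ d, finrank ℂ V = d + 1 := ⟨finrank ℂ V - 1, by have : 0 < finrank ℂ V := finrank_pos; omega⟩
  simp only [hd, Nat.add_sub_cancel]
  set M : ℕ → ℝ := fun m => ∫ ζ : Metric.sphere (0 : V) 1, (‖inner ℂ e (ζ : V)‖ ^ 2) ^ m ∂sphereMeasure V
  have hM0 : ∀ m, 0 ≤ M m := fun m => integral_nonneg fun ζ => by positivity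
  have ha : ∀ ζ : Metric.sphere (0 : V) 1, ‖inner ℂ e (ζ : V)‖ ^ 2 ≤ 1 := fun ζ =>
    pow_le_one₀ (norm_nonneg _) (norm_inner_sphere_le_one he ζ)
  -- Termwise integration of the negative binomial series turns the ellipsoid integral into a
  -- generating function of the moments.
  have key : ∀ y : ℝ, |y| < 1 → HasSum (fun m => ((m + d).choose d * M m) * y ^ m) (1 - y)⁻¹ := by
    intro y hy
    rw [← integral_sphere_inv_one_sub_pow he (lt_of_abs_lt hy), hd]
    have hsum : ∀ ζ : Metric.sphere (0 : V) 1, HasSum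
        (fun m => ((m + d).choose d : ℝ) * (y * ‖inner ℂ e (ζ : V)‖ ^ 2) ^ m)
        ((1 - y * ‖inner ℂ e (ζ : V)‖ ^ 2) ^ (d + 1))⁻¹ := by
      intro ζ
      rw [← one_div]
      refine hasSum_choose_mul_geometric_of_norm_lt_one d ?_
      rw [Real.norm_eq_abs, abs_mul, abs_of_nonneg (sq_nonneg ‖inner ℂ e (ζ : V)‖)]
      nlinarith [abs_nonneg y, ha ζ, sq_nonneg ‖inner ℂ e (ζ : V)‖]
    have hI : ∀ m, Integrable (fun ζ : Metric.sphere (0 : V) 1 =>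
        ((m + d).choose d : ℝ) * (y * ‖inner ℂ e (ζ : V)‖ ^ 2) ^ m) (sphereMeasure V) := fun m =>
      integrable_of_continuous_of_compactSpace (by fun_prop)
    have h := hasSum_integral_of_summable_integral_norm hI ?_
    · simp_rw [fun ζ => (hsum ζ).tsum_eq] at h
      convert! h using 2 with m
      simp_rw [mul_pow, integral_const_mul]
      ring
    · refine Summable.of_nonneg_of_le (fun m => integral_nonneg fun ζ => norm_nonneg _) (fun m => ?_)
        (summable_choose_mul_geometric_of_norm_lt_one (R := ℝ) d (r := |y|) (by simpa using hy))
      have : ∫ ζ : Metric.sphere (0 : V) 1, ((m + d).choose d : ℝ) * |y| ^ m ∂sphereMeasure V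
          = ((m + d).choose d : ℝ) * |y| ^ m := by simp
      rw [← this]
      refine integral_mono (hI m).norm (integrable_const _) fun ζ => ?_
      simp only [norm_mul, norm_pow, Real.norm_eq_abs, Nat.abs_cast, mul_pow]
      gcongr
      rw [abs_norm]
      exact mul_le_of_le_one_right (by positivity) (pow_le_one₀ (by positivity) (ha ζ))
  -- Two power series of (1 - y)⁻¹ at 0, the one with the moments and the geometric one, have equal
  -- coefficients.
  have hp : HasFPowerSeriesAt (fun y : ℝ => (1 - y)⁻¹)
      (FormalMultilinearSeries.ofScalars ℝ fun m => (m + d).choose d * M m) 0 := by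
    rw [hasFPowerSeriesAt_iff]
    filter_upwards [Metric.ball_mem_nhds (0 : ℝ) one_pos] with y hy
    simpa [mul_comm] using key y (by simpa using hy)
  have hq : HasFPowerSeriesAt (fun y : ℝ => (1 - y)⁻¹)
      (FormalMultilinearSeries.ofScalars ℝ fun _ => (1 : ℝ)) 0 := by
    rw [hasFPowerSeriesAt_iff]
    filter_upwards [Metric.ball_mem_nhds (0 : ℝ) one_pos] with y hy
    simpa using hasSum_geometric_of_abs_lt_one (r := y) (by simpa using hy)
  have := congrArg (fun p => FormalMultilinearSeries.coeff p m) (hp.eq_formalMultilinearSeries hq)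
  simpa using this

/-- A holomorphic function can be replaced by its restriction to the line `ℂ e` when it is
integrated against a function of `⟨ζ, e⟩`. -/
theorem integral_sphere_mul_eq_integral_restrict_line [Nontrivial V] {e : V} (he : ‖e‖ = 1) {R : ℝ}
    (hR : 1 < R) {h : V → ℂ} (hh : DifferentiableOn ℂ h (Metric.ball 0 R)) {F : ℂ → ℂ}
    (hF : Continuous fun ζ : Metric.sphere (0 : V) 1 => F (inner ℂ e (ζ : V))) :
    ∫ ζ : Metric.sphere (0 : V) 1, h ζ * F (inner ℂ e (ζ : V)) ∂sphereMeasure V =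
      ∫ ζ : Metric.sphere (0 : V) 1, h (inner ℂ e (ζ : V) • e) * F (inner ℂ e (ζ : V))
        ∂sphereMeasure V := by
  have hee : inner ℂ e e = (1 : ℂ) := by simp [inner_self_eq_norm_sq_to_K, he]
  have : FiniteDimensional ℝ V := FiniteDimensional.complexToReal V
  -- the partial rotations
  let A : ℂ → V → V := fun c w => inner ℂ e w • e + c • (w - inner ℂ e w • e)
  have hAn : ∀ c w, ‖A c w‖ ^ 2 = ‖inner ℂ e w‖ ^ 2 + ‖c‖ ^ 2 * (‖w‖ ^ 2 - ‖inner ℂ e w‖ ^ 2) := by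
    intro c w
    have horth : inner ℂ (inner ℂ e w • e) (w - inner ℂ e w • e) = 0 := by
      simp only [inner_smul_left, inner_sub_right, inner_smul_right, hee, mul_one]
      ring
    have hw : ‖w‖ ^ 2 = ‖inner ℂ e w • e‖ ^ 2 + ‖w - inner ℂ e w • e‖ ^ 2 := by
      have := norm_add_sq_eq_norm_sq_add_norm_sq_of_inner_eq_zero _ _ horth
      simpa [sq] using this
    have h2 := norm_add_sq_eq_norm_sq_add_norm_sq_of_inner_eq_zero (inner ℂ e w • e)
      (c • (w - inner ℂ e w • e)) (𝕜 := ℂ) (by rw [inner_smul_right, horth, mul_zero])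
    rw [norm_smul, he, mul_one] at hw
    simp only [A]
    rw [sq, h2, norm_smul, norm_smul, he]
    linear_combination (-‖c‖ ^ 2) * hw
  -- On the sphere ‖A c ζ‖² is a convex combination of 1 and ‖c‖², with weights |⟨ζ, e⟩|² and 1 -
  -- |⟨ζ, e⟩|²; both numbers are below R².
  have hAlt : ∀ c, ‖c‖ < R → ∀ ζ : Metric.sphere (0 : V) 1, A c ζ ∈ Metric.ball (0 : V) R := by
    intro c hc ζ
    have h1 := pow_le_one₀ (n := 2) (norm_nonneg _) (norm_inner_sphere_le_one he ζ)
    have h2 := hAn c ζ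
    have h3 : ‖(ζ : V)‖ = 1 := by simp
    rw [h3] at h2
    rw [mem_ball_zero_iff]
    refine lt_of_pow_lt_pow_left₀ 2 (by linarith) ?_
    have h4 : ‖c‖ ^ 2 < R ^ 2 := by gcongr
    have h5 : 1 < R ^ 2 := by nlinarith
    have h6 := sq_nonneg ‖inner ℂ e (ζ : V)‖
    rcases eq_or_lt_of_le h1 with h7 | h7 <;> nlinarith
  let U : (c : ℂ) → ‖c‖ = 1 → V →ₗᵢ[ℝ] V := fun c hc =>
    { toFun := A c
      map_add' := fun x y => by simp only [A, inner_add_right, add_smul]; module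
      map_smul' := fun r x => by
        simp only [A, ← Complex.coe_smul, inner_smul_right, RingHom.id_apply]; module
      norm_map' := fun x => by
        have := hAn c x
        rw [hc] at this
        change ‖A c x‖ = ‖x‖
        rw [← sq_eq_sq₀ (norm_nonneg _) (norm_nonneg _), this]; ring }
  have hAe : ∀ c w, inner ℂ e (A c w) = inner ℂ e w := by
    intro c w
    simp only [A, inner_add_right, inner_smul_right, inner_sub_right, hee]
    ring
  have hhc : ∀ {Y : Type _} [TopologicalSpace Y] {f : Y → V}, Continuous f →
      (∀ y, f y ∈ Metric.ball (0 : V) R) → Continuous fun y => h (f y) := fun hf hm =>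
    hh.continuousOn.comp_continuous hf hm
  -- For unimodular c the map A c is an isometry that does not change ⟨ζ, e⟩, so the integral is
  -- independent of c and may be averaged over the circle.
  have h1 : ∀ c : ℂ, ‖c‖ = 1 →
      ∫ ζ : Metric.sphere (0 : V) 1, h (A c ζ) * F (inner ℂ e (ζ : V)) ∂sphereMeasure V =
      ∫ ζ : Metric.sphere (0 : V) 1, h ζ * F (inner ℂ e (ζ : V)) ∂sphereMeasure V := by
    intro c hc
    conv_rhs => rw [← (measurePreserving_sphereMap (U c hc)).map_eq]
    have hcont : Continuous fun ζ : Metric.sphere (0 : V) 1 => h ζ * F (inner ℂ e (ζ : V)) :=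
      (hh.continuousOn.comp_continuous continuous_subtype_val fun ζ => by simpa using hR).mul hF
    rw [integral_map (continuous_sphereMap _).aemeasurable hcont.aestronglyMeasurable]
    refine integral_congr_ae (ae_of_all _ fun ζ => ?_)
    have : ((sphereMap (U c hc) ζ : Metric.sphere (0 : V) 1) : V) = A c ζ := rfl
    simp only [this, hAe]
  -- Mean value property of the holomorphic function c ↦ h(A c ζ): its average is the value at c =
  -- 0, where A 0 is the projection onto the line.
  have h2 : ∀ ζ : Metric.sphere (0 : V) 1,
      Real.circleAverage (fun c => h (A c ζ)) 0 1 = h (inner ℂ e (ζ : V) • e) := by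
    intro ζ
    have hd : DifferentiableOn ℂ (fun c => h (A c ζ)) (Metric.ball 0 R) := by
      refine hh.comp (Differentiable.differentiableOn (by fun_prop)) fun c hc => ?_
      exact hAlt c (by simpa using hc) ζ
    have := (hd.mono (by rw [abs_one]; exact Metric.closedBall_subset_ball hR :
      Metric.closedBall (0 : ℂ) |1| ⊆ Metric.ball 0 R)).diffContOnCl_ball (Subset.refl _) |>.circleAverage
    rw [this]
    simp [A]
  have h3 : ∀ ζ : Metric.sphere (0 : V) 1, h (inner ℂ e (ζ : V) • e) * F (inner ℂ e (ζ : V)) =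
      (2 * Real.pi)⁻¹ * ∫ θ in (0 : ℝ)..2 * Real.pi,
        h (A (circleMap 0 1 θ) ζ) * F (inner ℂ e (ζ : V)) := by
    intro ζ
    rw [← h2, Real.circleAverage_def, intervalIntegral.integral_mul_const]
    simp [mul_assoc]
  simp_rw [h3]
  rw [integral_const_mul, ← intervalIntegral_integral_swap]
  · have h4 : ∀ θ : ℝ, ∫ ζ : Metric.sphere (0 : V) 1,
        h (A (circleMap 0 1 θ) ζ) * F (inner ℂ e (ζ : V)) ∂sphereMeasure V =
        ∫ ζ : Metric.sphere (0 : V) 1, h ζ * F (inner ℂ e (ζ : V)) ∂sphereMeasure V := fun θ =>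
      h1 _ (by simp)
    simp_rw [h4]
    simp
    field_simp
  · have hcont : Continuous (Function.uncurry fun (θ : ℝ) (ζ : Metric.sphere (0 : V) 1) =>
        h (A (circleMap 0 1 θ) ζ) * F (inner ℂ e (ζ : V))) := by
      refine Continuous.mul (hhc ?_ fun p => hAlt _ (by simpa using hR) _) (hF.comp continuous_snd)
      fun_prop
    have h5 := (hcont.continuousOn (s := uIcc 0 (2 * Real.pi) ×ˢ univ)).integrableOn_compact
      (μ := (volume : Measure ℝ).prod (sphereMeasure V)) (isCompact_uIcc.prod isCompact_univ)
    rw [IntegrableOn, ← Measure.prod_restrict, Measure.restrict_univ] at h5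
    exact h5.mono_measure (Measure.prod_mono (Measure.restrict_mono uIoc_subset_uIcc le_rfl) le_rfl)

end Sphere

/-! ### Cauchy formula in the unit ball. -/

section Sphere

open Module

variable {V : Type*} [NormedAddCommGroup V] [InnerProductSpace ℂ V] [FiniteDimensional ℂ V]
  [MeasureSpace V] [BorelSpace V] [(volume : Measure V).IsAddHaarMeasure]

theorem one_sub_ne_zero_of_norm_lt_one {x : ℂ} (hx : ‖x‖ < 1) : 1 - x ≠ 0 := by
  intro h
  rw [← sub_eq_zero.1 h, norm_one] at hx
  exact lt_irrefl _ hx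

/-- In the expansion of the kernel only the term of degree j survives, by orthogonality, and its
binomial coefficient cancels against the moment of order j. -/
theorem integral_inner_pow_mul_one_div [Nontrivial V] {e : V} (he : ‖e‖ = 1) {ρ : ℝ} (hρ0 : 0 ≤ ρ)
    (hρ : ρ < 1) (j : ℕ) :
    ∫ ζ : Metric.sphere (0 : V) 1, inner ℂ e (ζ : V) ^ j *
      (1 / (1 - ρ * conj (inner ℂ e (ζ : V))) ^ finrank ℂ V) ∂sphereMeasure V = (ρ : ℂ) ^ j := by
  obtain ⟨d, hd⟩ : ∃ d, finrank ℂ V = d + 1 :=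
    ⟨finrank ℂ V - 1, by have : 0 < finrank ℂ V := finrank_pos; omega⟩
  have ha := norm_inner_sphere_le_one he
  have hlt : ∀ ζ : Metric.sphere (0 : V) 1, ‖(ρ : ℂ) * conj (inner ℂ e (ζ : V))‖ < 1 := by
    intro ζ
    rw [norm_mul, RCLike.norm_conj, Complex.norm_real, Real.norm_eq_abs, abs_of_nonneg hρ0]
    nlinarith [ha ζ]
  have hsum : ∀ ζ : Metric.sphere (0 : V) 1, HasSum
      (fun m => inner ℂ e (ζ : V) ^ j *
        (((m + d).choose d : ℂ) * (ρ * conj (inner ℂ e (ζ : V))) ^ m))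
      (inner ℂ e (ζ : V) ^ j * (1 / (1 - ρ * conj (inner ℂ e (ζ : V))) ^ (d + 1))) := fun ζ =>
    (hasSum_choose_mul_geometric_of_norm_lt_one d (hlt ζ)).mul_left _
  have hI : ∀ m, Integrable (fun ζ : Metric.sphere (0 : V) 1 => inner ℂ e (ζ : V) ^ j *
      (((m + d).choose d : ℂ) * (ρ * conj (inner ℂ e (ζ : V))) ^ m)) (sphereMeasure V) := fun m =>
    integrable_of_continuous_of_compactSpace (by fun_prop)
  have h := hasSum_integral_of_summable_integral_norm hI ?_
  · simp_rw [fun ζ => (hsum ζ).tsum_eq] at h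
    rw [hd]
    refine h.unique ?_
    have hterm : ∀ m, ∫ ζ : Metric.sphere (0 : V) 1, inner ℂ e (ζ : V) ^ j *
        (((m + d).choose d : ℂ) * (ρ * conj (inner ℂ e (ζ : V))) ^ m) ∂sphereMeasure V =
        ((m + d).choose d : ℂ) * ρ ^ m * ∫ ζ : Metric.sphere (0 : V) 1,
          inner ℂ e (ζ : V) ^ j * conj (inner ℂ e (ζ : V)) ^ m ∂sphereMeasure V := by
      intro m
      rw [← integral_const_mul]
      congr with ζ
      ring
    simp_rw [hterm]
    set T : ℕ → ℂ := fun m => ((m + d).choose d : ℂ) * ρ ^ m * ∫ ζ : Metric.sphere (0 : V) 1,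
      inner ℂ e (ζ : V) ^ j * conj (inner ℂ e (ζ : V)) ^ m ∂sphereMeasure V
    have hTj : T j = (ρ : ℂ) ^ j := by
      have h1 := choose_mul_integral_norm_inner_pow he j
      rw [hd, Nat.add_sub_cancel] at h1
      have h2 : ∫ ζ : Metric.sphere (0 : V) 1,
          inner ℂ e (ζ : V) ^ j * conj (inner ℂ e (ζ : V)) ^ j ∂sphereMeasure V =
          ((∫ ζ : Metric.sphere (0 : V) 1, (‖inner ℂ e (ζ : V)‖ ^ 2) ^ j ∂sphereMeasure V : ℝ) : ℂ) := by
        rw [← integral_complex_ofReal]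
        congr with ζ
        rw [← mul_pow, Complex.mul_conj, Complex.normSq_eq_norm_sq]
        simp
      simp only [T]
      rw [h2, mul_right_comm]
      have h3 : ((((j + d).choose d : ℝ) * ∫ ζ : Metric.sphere (0 : V) 1,
        (‖inner ℂ e (ζ : V)‖ ^ 2) ^ j ∂sphereMeasure V : ℝ) : ℂ) = 1 := by rw [h1]; simp
      push_cast at h3 ⊢
      rw [h3, one_mul]
    rw [← hTj]
    refine hasSum_single j fun m hm => ?_
    simp only [T]
    rw [integral_inner_pow_mul_conj_pow_eq_zero e hm.symm, mul_zero]
  · refine Summable.of_nonneg_of_le (fun m => integral_nonneg fun ζ => norm_nonneg _) (fun m => ?_)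
      (summable_choose_mul_geometric_of_norm_lt_one (R := ℝ) d (r := ρ)
        (by rwa [Real.norm_eq_abs, abs_of_nonneg hρ0]))
    have : ∫ ζ : Metric.sphere (0 : V) 1, ((m + d).choose d : ℝ) * ρ ^ m ∂sphereMeasure V
        = ((m + d).choose d : ℝ) * ρ ^ m := by simp
    rw [← this]
    refine integral_mono (hI m).norm (integrable_const _) fun ζ => ?_
    simp only [norm_mul, norm_pow, mul_pow, RCLike.norm_conj, Complex.norm_natCast,
      Complex.norm_real, Real.norm_eq_abs, abs_of_nonneg hρ0]
    refine (mul_le_of_le_one_left (by positivity) (pow_le_one₀ (norm_nonneg _) (ha ζ))).trans ?_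
    gcongr
    exact mul_le_of_le_one_right (by positivity) (pow_le_one₀ (norm_nonneg _) (ha ζ))

/-- The **Cauchy formula** in the unit ball. -/
theorem integral_sphere_cauchy [Nontrivial V] {R : ℝ} (hR : 1 < R) {h : V → ℂ}
    (hh : DifferentiableOn ℂ h (Metric.ball 0 R)) {z : V} (hz : ‖z‖ < 1) :
    ∫ ζ : Metric.sphere (0 : V) 1, 1 / (1 - inner ℂ (ζ : V) z) ^ finrank ℂ V * h ζ
      ∂sphereMeasure V = h z := by
  -- The direction of z; any unit vector serves when z = 0.
  obtain ⟨e, he, hze⟩ : ∃ e : V, ‖e‖ = 1 ∧ z = ((‖z‖ : ℝ) : ℂ) • e := by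
    by_cases h0 : z = 0
    · obtain ⟨e, he⟩ := exists_norm_eq V zero_le_one
      exact ⟨e, he, by simp [h0]⟩
    · have h1 : ((‖z‖ : ℝ) : ℂ) ≠ 0 := by exact_mod_cast norm_ne_zero_iff.2 h0
      refine ⟨((‖z‖ : ℝ) : ℂ)⁻¹ • z, ?_, by rw [smul_inv_smul₀ h1]⟩
      rw [norm_smul]
      simp [norm_ne_zero_iff.2 h0]
  set ρ := ‖z‖ with hρ
  have ha := norm_inner_sphere_le_one he
  let F : ℂ → ℂ := fun a => 1 / (1 - ρ * conj a) ^ finrank ℂ V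
  have hFc : Continuous fun ζ : Metric.sphere (0 : V) 1 => F (inner ℂ e (ζ : V)) := by
    refine Continuous.div (by fun_prop) (by fun_prop) fun ζ => pow_ne_zero _ ?_
    refine one_sub_ne_zero_of_norm_lt_one ?_
    rw [norm_mul, RCLike.norm_conj, Complex.norm_real, Real.norm_eq_abs, abs_of_nonneg (norm_nonneg z)]
    nlinarith [ha ζ, norm_nonneg z]
  have h1 : ∀ ζ : Metric.sphere (0 : V) 1,
      1 / (1 - inner ℂ (ζ : V) z) ^ finrank ℂ V * h ζ = h ζ * F (inner ℂ e (ζ : V)) := by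
    intro ζ
    simp only [F]
    rw [hze, inner_smul_right, inner_conj_symm, mul_comm]
  simp_rw [h1]
  rw [integral_sphere_mul_eq_integral_restrict_line he hR hh hFc]
  -- A radius strictly between 1 and R makes the Taylor coefficients on the line absolutely
  -- summable, which justifies termwise integration over the sphere.
  obtain ⟨R', hR'1, hR'⟩ := exists_between hR
  lift R' to NNReal using by linarith
  set g : ℂ → ℂ := fun a => h (a • e) with hg
  have hgd : DifferentiableOn ℂ g (Metric.ball 0 R) := by
    refine hh.comp (Differentiable.differentiableOn (by fun_prop)) fun a ha => ?_
    simpa [norm_smul, he] using ha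
  have hps := (hgd.mono (Metric.closedBall_subset_ball hR')).hasFPowerSeriesOnBall
    (by exact_mod_cast (by linarith : (0 : ℝ) < R'))
  set p := cauchyPowerSeries g 0 R' with hp
  have hgs : ∀ a : ℂ, ‖a‖ < R' → HasSum (fun j => p.coeff j * a ^ j) (g a) := by
    intro a ha
    have := hps.hasSum (y := a) (by
      rw [Metric.mem_eball, edist_zero_right, enorm_eq_nnnorm]
      exact ENNReal.coe_lt_coe.2 (by exact_mod_cast ha))
    simpa [mul_comm] using this
  have hcs : Summable fun j => ‖p.coeff j‖ := by
    have := p.summable_norm_mul_pow (r := 1) (lt_of_lt_of_le (by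
      exact_mod_cast hR'1) hps.r_le)
    simpa using this
  have hI : ∀ j, Integrable (fun ζ : Metric.sphere (0 : V) 1 =>
      p.coeff j * inner ℂ e (ζ : V) ^ j * F (inner ℂ e (ζ : V))) (sphereMeasure V) := fun j =>
    integrable_of_continuous_of_compactSpace ((by fun_prop : Continuous fun ζ :
      Metric.sphere (0 : V) 1 => p.coeff j * inner ℂ e (ζ : V) ^ j).mul hFc)
  have hint := hasSum_integral_of_summable_integral_norm hI ?_
  · have h2 : ∀ ζ : Metric.sphere (0 : V) 1,
        ∑' j, p.coeff j * inner ℂ e (ζ : V) ^ j * F (inner ℂ e (ζ : V)) =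
        h (inner ℂ e (ζ : V) • e) * F (inner ℂ e (ζ : V)) := fun ζ =>
      ((hgs _ ((ha ζ).trans_lt hR'1)).mul_right _).tsum_eq
    simp_rw [h2] at hint
    refine hint.unique ?_
    have h3 : ∀ j, ∫ ζ : Metric.sphere (0 : V) 1,
        p.coeff j * inner ℂ e (ζ : V) ^ j * F (inner ℂ e (ζ : V)) ∂sphereMeasure V =
        p.coeff j * (ρ : ℂ) ^ j := by
      intro j
      simp_rw [mul_assoc]
      rw [integral_const_mul, integral_inner_pow_mul_one_div he (norm_nonneg z) hz]
    simp_rw [h3]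
    rw [hze]
    refine hgs ρ ?_
    rw [Complex.norm_real, Real.norm_eq_abs, abs_of_nonneg (norm_nonneg z)]
    linarith
  · obtain ⟨C, hC⟩ := isCompact_univ.exists_bound_of_continuousOn hFc.continuousOn
    refine Summable.of_nonneg_of_le (fun m => integral_nonneg fun ζ => norm_nonneg _) (fun m => ?_)
      (hcs.mul_right C)
    have : ∫ ζ : Metric.sphere (0 : V) 1, ‖p.coeff m‖ * C ∂sphereMeasure V = ‖p.coeff m‖ * C := by
      simp
    rw [← this]
    refine integral_mono (hI m).norm (integrable_const _) fun ζ => ?_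
    simp only [norm_mul, norm_pow]
    have := hC ζ (mem_univ _)
    gcongr
    exact mul_le_of_le_one_right (norm_nonneg _) (pow_le_one₀ (norm_nonneg _) (ha ζ))

end Sphere

/-! ### Cauchy formula in the product of balls. -/

section Product

/-- Replacing one coordinate by an independent one preserves a product of probability measures. -/
theorem measurePreserving_update {ι : Type*} [Fintype ι] [DecidableEq ι] {X : ι → Type*}
    [∀ i, MeasurableSpace (X i)] (μ : ∀ i, Measure (X i)) [∀ i, IsProbabilityMeasure (μ i)]
    (j : ι) :
    MeasurePreserving (fun p : (∀ i, X i) × X j => Function.update p.1 j p.2)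
      ((Measure.pi μ).prod (μ j)) (Measure.pi μ) := by
  have hm : Measurable fun p : (∀ i, X i) × X j => Function.update p.1 j p.2 := by
    rw [measurable_pi_iff]
    intro i
    by_cases hij : i = j
    · subst hij; simpa using measurable_snd
    · simp only [Function.update_of_ne hij]
      exact (measurable_pi_apply i).comp measurable_fst
  refine ⟨hm, (Measure.pi_eq fun s hs => ?_).symm⟩
  rw [Measure.map_apply hm (MeasurableSet.univ_pi hs)]
  have : (fun p : (∀ i, X i) × X j => Function.update p.1 j p.2) ⁻¹' univ.pi s =
      (univ.pi (Function.update s j univ)) ×ˢ s j := by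
    ext ⟨ζ, x⟩
    simp only [mem_preimage, Set.mem_pi, mem_univ, forall_const, mem_prod]
    constructor
    · intro h
      refine ⟨fun i => ?_, by simpa using h j⟩
      by_cases hij : i = j
      · subst hij; simp
      · simpa [Function.update_of_ne hij] using h i
    · rintro ⟨h1, h2⟩ i
      by_cases hij : i = j
      · subst hij; simpa using h2
      · simpa [Function.update_of_ne hij] using h1 i
  rw [this, Measure.prod_prod, Measure.pi_pi, ← Finset.mul_prod_erase _ _ (Finset.mem_univ j),
    ← Finset.mul_prod_erase Finset.univ (fun i => μ i (s i)) (Finset.mem_univ j)]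
  simp only [Function.update_self, measure_univ, one_mul]
  rw [mul_comm]
  congr 1
  refine Finset.prod_congr rfl fun i hi => ?_
  rw [Function.update_of_ne (Finset.ne_of_mem_erase hi)]

variable {k : ℕ} {n : Fin k → ℕ} [∀ j, NeZero (n j)]

instance {m : ℕ} [NeZero m] : IsProbabilityMeasure (sphereMeasure (EuclideanSpace ℂ (Fin m))) :=
  inferInstance

instance : IsProbabilityMeasure (boundaryMeasure n) := by
  unfold boundaryMeasure; infer_instance

/-- The **Cauchy formula** in the product of balls. -/
theorem integral_cauchyKernel_mul {R : ℝ} (hR : 1 < R) {h : Ambient n → ℂ}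
    (hh : DifferentiableOn ℂ h {w | ∀ j, ‖w j‖ < R}) {z : Ambient n} (hz : z ∈ domain n) :
    ∫ ζ, cauchyKernel z (toAmbient ζ) * h (toAmbient ζ) ∂boundaryMeasure n = h z := by
  let c : (j : Fin k) → Metric.sphere (0 : EuclideanSpace ℂ (Fin (n j))) 1 → ℂ := fun j ζ =>
    1 / (1 - inner ℂ (ζ : EuclideanSpace ℂ (Fin (n j))) (z j)) ^ n j
  have hc : ∀ j, Continuous (c j) := by
    intro j
    refine Continuous.div (by fun_prop) (by fun_prop) fun ζ => pow_ne_zero _ ?_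
    refine one_sub_ne_zero_of_norm_lt_one ((norm_inner_le_norm _ _).trans_lt ?_)
    simpa using hz j
  -- The coordinates in s remain integration variables, the others are already replaced by those of
  -- z. Induction on s removes one variable at a time by the formula in a single ball.
  let mix : Finset (Fin k) → DistBoundary n → Ambient n := fun s ζ i =>
    if i ∈ s then (ζ i : EuclideanSpace ℂ (Fin (n i))) else z i
  have hmixc : ∀ s, Continuous (mix s) := by
    intro s
    refine continuous_pi fun i => ?_
    by_cases hi : i ∈ s
    · simp only [mix, hi, if_true]; fun_prop
    · simp only [mix, hi, if_false]; fun_prop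
  have hmixm : ∀ s ζ i, ‖mix s ζ i‖ < R := by
    intro s ζ i
    by_cases hi : i ∈ s
    · simpa [mix, hi] using hR
    · simpa [mix, hi] using (hz i).trans hR
  have key : ∀ s : Finset (Fin k),
      ∫ ζ, (∏ j ∈ s, c j (ζ j)) * h (mix s ζ) ∂boundaryMeasure n = h z := by
    intro s
    induction s using Finset.induction_on with
    | empty => simp [mix]
    | insert j s hj ih =>
      rw [← ih]
      let G : DistBoundary n → ℂ := fun ζ => (∏ i ∈ insert j s, c i (ζ i)) * h (mix (insert j s) ζ)
      have hG : Continuous G := by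
        refine Continuous.mul ?_ (hh.continuousOn.comp_continuous (hmixc _) (hmixm _))
        exact continuous_finsetProd _ fun i _ => (hc i).comp (continuous_apply i)
      have hmp := measurePreserving_update
        (fun j => sphereMeasure (EuclideanSpace ℂ (Fin (n j)))) j
      have hup : Continuous fun p : DistBoundary n ×
          Metric.sphere (0 : EuclideanSpace ℂ (Fin (n j))) 1 => Function.update p.1 j p.2 :=
        continuous_fst.update j continuous_snd
      -- Resampling coordinate j from an independent copy x isolates it, so that Fubini can be
      -- applied without splitting the product space.
      have h0 : ∫ ζ, G ζ ∂boundaryMeasure n = ∫ ζ, ∫ x, G (Function.update ζ j x)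
          ∂sphereMeasure (EuclideanSpace ℂ (Fin (n j))) ∂boundaryMeasure n := by
        conv_lhs => rw [boundaryMeasure, ← hmp.map_eq]
        rw [integral_map hmp.measurable.aemeasurable hG.aestronglyMeasurable]
        exact integral_prod (fun p => G (Function.update p.1 j p.2))
          (integrable_of_continuous_of_compactSpace (hG.comp hup))
      refine h0.trans ?_
      congr with ζ
      have h1 : ∀ x, G (Function.update ζ j x) = (∏ i ∈ s, c i (ζ i)) *
          (c j x * h (Function.update (mix s ζ) j x)) := by
        intro x
        have h2 : mix (insert j s) (Function.update ζ j x) = Function.update (mix s ζ) j x := by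
          ext1 i
          by_cases hij : i = j
          · subst hij; simp [mix]
          · simp [mix, hij]
        have h3 : ∏ i ∈ s, c i (Function.update ζ j x i) = ∏ i ∈ s, c i (ζ i) :=
          Finset.prod_congr rfl fun i hi => by
            rw [Function.update_of_ne (show i ≠ j from fun h => hj (h ▸ hi))]
        simp only [G]
        rw [h2, Finset.prod_insert hj, h3, Function.update_self]
        ring
      simp_rw [h1]
      rw [integral_const_mul]
      congr 1
      have hd : DifferentiableOn ℂ (fun w => h (Function.update (mix s ζ) j w))
          (Metric.ball 0 R) := by
        refine hh.comp (fun w _ => (hasFDerivAt_update _ _).differentiableAt.differentiableWithinAt)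
          fun w hw i => ?_
        by_cases hij : i = j
        · subst hij; simpa using hw
        · simpa [Function.update_of_ne hij] using hmixm s ζ i
      have h4 := integral_sphere_cauchy hR hd (hz j)
      rw [finrank_euclideanSpace_fin] at h4
      rw [h4]
      congr 1
      ext1 i
      by_cases hij : i = j
      · subst hij; simp [mix, hj]
      · simp [Function.update_of_ne hij]
  have := key Finset.univ
  have hmix : ∀ ζ, mix Finset.univ ζ = toAmbient ζ := fun ζ => by
    ext1 i
    simp [mix, toAmbient]
  simp_rw [hmix] at this
  simpa [ cauchyKernel, toAmbient, c] using this

end Product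

/-! ### The Poisson type kernel: reproducing property and approximate identity. -/

section Poisson

variable {k : ℕ} {n : Fin k → ℕ}

/-- The Poisson type kernel as a real function. -/
def realPoisson (z : Ambient n) (ζ : DistBoundary n) : ℝ :=
  ∏ j, ((1 - ‖z j‖ ^ 2) / ‖1 - inner ℂ (toAmbient ζ j) (z j)‖ ^ 2) ^ n j

theorem poissonKernel_eq_realPoisson (z : Ambient n) (ζ : DistBoundary n) :
    poissonKernel z ζ = realPoisson z ζ := by
  simp only [poissonKernel, cauchyKernel, realPoisson, ← Finset.prod_mul_distrib,
    ← Finset.prod_div_distrib]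
  push_cast
  refine Finset.prod_congr rfl fun j _ => ?_
  have h1 : (1 : ℂ) - inner ℂ (z j) (toAmbient ζ j) =
      conj (1 - inner ℂ (toAmbient ζ j) (z j)) := by
    rw [map_sub, map_one, inner_conj_symm]
  rw [← one_div_pow, ← one_div_pow, ← one_div_pow, ← mul_pow, ← div_pow, h1,
    inner_self_eq_norm_sq_to_K, one_div_mul_one_div, Complex.mul_conj, Complex.normSq_eq_norm_sq]
  congr 1
  push_cast
  rw [div_div_eq_mul_div, div_one]
  simp [div_eq_mul_inv, mul_comm]

theorem norm_inner_toAmbient_lt_one {z : Ambient n} (hz : z ∈ domain n) (ζ : DistBoundary n)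
    (j : Fin k) : ‖inner ℂ (toAmbient ζ j) (z j)‖ < 1 := by
  refine (norm_inner_le_norm _ _).trans_lt ?_
  simpa [toAmbient] using hz j

theorem realPoisson_nonneg {z : Ambient n} (hz : z ∈ domain n) (ζ : DistBoundary n) :
    0 ≤ realPoisson z ζ := by
  refine Finset.prod_nonneg fun j _ => pow_nonneg (div_nonneg ?_ (sq_nonneg _)) _
  have := hz j
  nlinarith [norm_nonneg (z j)]

theorem continuous_toAmbient : Continuous (toAmbient : DistBoundary n → Ambient n) := by
  unfold toAmbient
  fun_prop

theorem continuous_dilate (r : ℝ) : Continuous (dilate r : DistBoundary n → Ambient n) := by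
  unfold dilate
  fun_prop

theorem continuous_realPoisson {Y : Type*} [TopologicalSpace Y] {f : Y → Ambient n}
    {g : Y → DistBoundary n} (hf : Continuous f) (hg : Continuous g) (hfd : ∀ y, f y ∈ domain n) :
    Continuous fun y => realPoisson (f y) (g y) := by
  have hg' : Continuous fun y => toAmbient (g y) := continuous_toAmbient.comp hg
  refine continuous_finsetProd _ fun j _ => Continuous.pow (Continuous.div (by fun_prop)
    (by fun_prop) fun y => pow_ne_zero _ (norm_ne_zero_iff.2 ?_)) _
  exact one_sub_ne_zero_of_norm_lt_one (norm_inner_toAmbient_lt_one (hfd y) _ _)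

theorem norm_dilate_apply (r : ℝ) (ζ : DistBoundary n) (j : Fin k) : ‖dilate r ζ j‖ = |r| := by
  simp [dilate, norm_smul]

/-- This symmetry lets Fubini move the Poisson smoothing from a measure to a test function. -/
theorem realPoisson_dilate_comm (r : ℝ) (ζ η : DistBoundary n) :
    realPoisson (dilate r ζ) η = realPoisson (dilate r η) ζ := by
  refine Finset.prod_congr rfl fun j _ => ?_
  have h : ‖(1 : ℂ) - inner ℂ (toAmbient η j) (dilate r ζ j)‖ =
      ‖(1 : ℂ) - inner ℂ (toAmbient ζ j) (dilate r η j)‖ := by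
    rw [← RCLike.norm_conj, map_sub, map_one, inner_conj_symm]
    simp only [dilate, toAmbient, ← Complex.coe_smul, inner_smul_left, inner_smul_right,
      Complex.conj_ofReal]
  rw [norm_dilate_apply, norm_dilate_apply, h]

theorem zero_mem_domain : (0 : Ambient n) ∈ domain n := fun j => by simp

theorem realPoisson_zero (ζ : DistBoundary n) : realPoisson 0 ζ = 1 := by
  simp [realPoisson]

theorem norm_lt_one_of_mem_domain {z : Ambient n} (hz : z ∈ domain n) : ‖z‖ < 1 :=
  (pi_norm_lt_iff one_pos).2 hz

theorem integrable_realPoisson_smul {E : Type*} [NormedAddCommGroup E] [NormedSpace ℝ E]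
    {z : Ambient n} (hz : z ∈ domain n) {f : DistBoundary n → E} (hf : Continuous f)
    {ν : Measure (DistBoundary n)} [IsFiniteMeasure ν] :
    Integrable (fun ζ => realPoisson z ζ • f ζ) ν :=
  integrable_of_continuous_of_compactSpace
    ((continuous_realPoisson continuous_const continuous_id fun _ => hz).smul hf)

variable [∀ j, NeZero (n j)]

/-- The Poisson kernel reproduces holomorphic functions. -/
theorem integral_realPoisson_mul {R : ℝ} (hR : 1 < R) {h : Ambient n → ℂ}
    (hh : DifferentiableOn ℂ h {w | ∀ j, ‖w j‖ < R}) {z : Ambient n} (hz : z ∈ domain n) :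
    ∫ ζ, (realPoisson z ζ : ℂ) * h (toAmbient ζ) ∂boundaryMeasure n = h z := by
  have hz1 := norm_lt_one_of_mem_domain hz
  have hz0 := norm_nonneg z
  -- The bound 2 / (1 + ‖z‖) exceeds 1 and keeps |⟨w_j, z_j⟩| < 1, because 2‖z‖ < 1 + ‖z‖; hence
  -- C(·, z) is holomorphic beyond the closed domain.
  set R' := min R (2 / (1 + ‖z‖)) with hR'
  have hR'1 : 1 < R' := lt_min hR (by rw [lt_div_iff₀ (by linarith)]; linarith)
  -- The Cauchy formula for h C(·, z) / C(z, z), whose value at z is h(z), is the Poisson formula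
  -- for h.
  let H : Ambient n → ℂ := fun w => h w * cauchyKernel w z / cauchyKernel z z
  have hd : DifferentiableOn ℂ H {w | ∀ j, ‖w j‖ < R'} := by
    have h1 : DifferentiableOn ℂ h {w | ∀ j, ‖w j‖ < R'} :=
      hh.mono fun w hw j => (hw j).trans_le (min_le_left _ _)
    suffices h2 : DifferentiableOn ℂ (fun w : Ambient n => cauchyKernel w z)
        {w | ∀ j, ‖w j‖ < R'} by
      simp only [H, div_eq_mul_inv]
      exact (h1.fun_mul h2).mul_const _
    have h3 : ∀ j, DifferentiableOn ℂ (fun w : Ambient n => 1 / (1 - inner ℂ (z j) (w j)) ^ n j)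
        {w | ∀ j, ‖w j‖ < R'} := by
      intro j
      have h4 : DifferentiableOn ℂ (fun w : Ambient n => (1 - inner ℂ (z j) (w j)) ^ n j)
          {w | ∀ j, ‖w j‖ < R'} :=
        (((differentiable_const _).sub ((innerSL ℂ (z j)).differentiable.comp
          (differentiable_apply j))).pow _).differentiableOn
      simp only [one_div]
      refine h4.fun_inv fun w hw => pow_ne_zero _ ?_
      refine one_sub_ne_zero_of_norm_lt_one ((norm_inner_le_norm _ _).trans_lt ?_)
      have h1 : ‖w j‖ < 2 / (1 + ‖z‖) := (hw j).trans_le (min_le_right _ _)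
      have h2 : ‖z j‖ ≤ ‖z‖ := norm_le_pi_norm z j
      rw [lt_div_iff₀ (by linarith)] at h1
      nlinarith [norm_nonneg (z j), norm_nonneg (w j)]
    have h5 : ∀ s : Finset (Fin k), DifferentiableOn ℂ (fun w : Ambient n =>
        ∏ j ∈ s, 1 / (1 - inner ℂ (z j) (w j)) ^ n j) {w | ∀ j, ‖w j‖ < R'} := by
      intro s
      induction s using Finset.induction_on with
      | empty => simp
      | insert j s hj ih =>
        simp only [Finset.prod_insert hj]
        exact (h3 j).fun_mul ih
    exact h5 Finset.univ
  have hC : cauchyKernel z z ≠ 0 := by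
    refine Finset.prod_ne_zero_iff.2 fun j _ => one_div_ne_zero (pow_ne_zero _ ?_)
    refine one_sub_ne_zero_of_norm_lt_one ((norm_inner_le_norm _ _).trans_lt ?_)
    nlinarith [hz j, norm_nonneg (z j)]
  have := integral_cauchyKernel_mul hR'1 hd hz
  simp only [H] at this
  rw [mul_div_cancel_right₀ _ hC] at this
  rw [← this]
  refine integral_congr_ae (ae_of_all _ fun ζ => ?_)
  simp only [← poissonKernel_eq_realPoisson, poissonKernel]
  ring

theorem integral_realPoisson_mul_dilate {h : Ambient n → ℂ}
    (hh : DifferentiableOn ℂ h (domain n)) {z : Ambient n} (hz : z ∈ domain n) {r : ℝ}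
    (hr : r ∈ Ioo (0 : ℝ) 1) :
    ∫ ζ, (realPoisson z ζ : ℂ) * h (dilate r ζ) ∂boundaryMeasure n = h (r • z) := by
  refine integral_realPoisson_mul (R := 1 / r) (h := fun w : Ambient n => h (r • w))
    (by rw [lt_div_iff₀ hr.1]; linarith [hr.2]) ?_ hz
  refine hh.comp (Differentiable.differentiableOn (differentiable_id.const_smul r)) fun w hw j => ?_
  have := hw j
  rw [lt_div_iff₀ hr.1] at this
  simpa [norm_smul, abs_of_pos hr.1, mul_comm] using this

theorem integral_realPoisson_mul_re_dilate {h : Ambient n → ℂ}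
    (hh : DifferentiableOn ℂ h (domain n)) {z : Ambient n} (hz : z ∈ domain n) {r : ℝ}
    (hr : r ∈ Ioo (0 : ℝ) 1) :
    ∫ ζ, realPoisson z ζ * (h (dilate r ζ)).re ∂boundaryMeasure n = (h (r • z)).re := by
  rw [← integral_realPoisson_mul_dilate hh hz hr]
  have hi := integrable_realPoisson_smul (ν := boundaryMeasure n) hz (continuous_comp_dilate hh hr)
  have := (integral_re hi)
  simpa using this

theorem integral_realPoisson {z : Ambient n} (hz : z ∈ domain n) :
    ∫ ζ, realPoisson z ζ ∂boundaryMeasure n = 1 := by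
  have h := integral_realPoisson_mul (n := n) one_lt_two (h := fun _ => 1)
    (differentiableOn_const _) hz
  simp only [mul_one] at h
  rw [integral_complex_ofReal] at h
  exact_mod_cast h

/-- On the sphere the squared distance is the real part of 2(1 - ⟨η_j, ζ_j⟩), holomorphic in η, so
its Poisson integral is the value at rζ. This second moment replaces pointwise estimates of the
kernel away from ζ. -/
theorem integral_realPoisson_mul_norm_sub_sq {r : ℝ} (hr : r ∈ Ioo (0 : ℝ) 1) (ζ : DistBoundary n)
    (j : Fin k) :
    ∫ η, realPoisson (dilate r ζ) η * ‖toAmbient ζ j - toAmbient η j‖ ^ 2 ∂boundaryMeasure n =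
      2 * (1 - r) := by
  have hz := mem_domain_dilate hr ζ
  have hζ : ‖toAmbient ζ j‖ = 1 := by simp [toAmbient]
  have h := integral_realPoisson_mul (n := n) one_lt_two
    (h := fun w => 2 * (1 - inner ℂ (toAmbient ζ j) (w j)))
    (Differentiable.differentiableOn (((differentiable_const _).sub
      ((innerSL ℂ (toAmbient ζ j)).differentiable.comp (differentiable_apply j))).const_mul _)) hz
  have hc : Continuous fun η : DistBoundary n =>
      2 * (1 - inner ℂ (toAmbient ζ j) (toAmbient η j)) := by
    have := continuous_toAmbient (n := n)
    fun_prop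
  have h2 := integral_re (integrable_realPoisson_smul (ν := boundaryMeasure n) hz hc)
  have h3 : ∀ η : DistBoundary n, realPoisson (dilate r ζ) η * ‖toAmbient ζ j - toAmbient η j‖ ^ 2 =
      RCLike.re (realPoisson (dilate r ζ) η • (2 * (1 - inner ℂ (toAmbient ζ j) (toAmbient η j)))) := by
    intro η
    have hη : ‖toAmbient η j‖ = 1 := by simp [toAmbient]
    rw [@norm_sub_sq ℂ, hζ, hη]
    simp
    left
    ring
  simp_rw [h3]
  rw [h2]
  simp only [Complex.real_smul]
  rw [h]
  have h4 : inner ℂ (toAmbient ζ j) (dilate r ζ j) = r := by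
    change inner ℂ (toAmbient ζ j) (r • toAmbient ζ j) = r
    rw [← Complex.coe_smul, inner_smul_right, inner_self_eq_norm_sq_to_K, hζ]
    simp
  rw [h4]
  simp

/-- The Poisson integrals of a continuous function converge uniformly to it. -/
theorem eventually_norm_integral_realPoisson_sub_le {ψ : DistBoundary n → ℂ} (hψ : Continuous ψ)
    {ε : ℝ} (hε : 0 < ε) :
    ∀ᶠ r in 𝓝[<] (1 : ℝ), r ∈ Ioo (0 : ℝ) 1 ∧ ∀ ζ,
      ‖∫ η, realPoisson (dilate r ζ) η • ψ η ∂boundaryMeasure n - ψ ζ‖ ≤ ε := by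
  obtain ⟨M, hM⟩ := isCompact_univ.exists_bound_of_continuousOn hψ.continuousOn
  have hM0 : 0 ≤ max M 0 := le_max_right _ _
  have hM' : ∀ ζ, ‖ψ ζ‖ ≤ max M 0 := fun ζ => (hM ζ (mem_univ _)).trans (le_max_left _ _)
  set M' := max M 0
  obtain ⟨δ, hδ, hu⟩ := Metric.uniformContinuous_iff.1
    (CompactSpace.uniformContinuous_of_continuous hψ) (ε / 2) (by positivity)
  -- Chebyshev-type bound: uniform continuity handles nearby points, and at distance at least δ some
  -- coordinate makes the sum at least δ².
  have hpt : ∀ ζ η, ‖ψ η - ψ ζ‖ ≤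
      ε / 2 + 2 * M' / δ ^ 2 * ∑ j, ‖toAmbient ζ j - toAmbient η j‖ ^ 2 := by
    intro ζ η
    have hs : 0 ≤ ∑ j, ‖toAmbient ζ j - toAmbient η j‖ ^ 2 := Finset.sum_nonneg fun _ _ => sq_nonneg _
    by_cases hd : dist η ζ < δ
    · have h1 := (hu hd).le
      rw [dist_eq_norm] at h1
      have : 0 ≤ 2 * M' / δ ^ 2 * ∑ j, ‖toAmbient ζ j - toAmbient η j‖ ^ 2 := by positivity
      linarith
    · have h2 : ∃ j, δ ≤ ‖toAmbient ζ j - toAmbient η j‖ := by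
        by_contra! hcon
        refine hd ((dist_pi_lt_iff hδ).2 fun j => ?_)
        rw [Subtype.dist_eq, dist_comm, dist_eq_norm]
        exact hcon j
      obtain ⟨j, hj⟩ := h2
      have h3 : δ ^ 2 ≤ ∑ j, ‖toAmbient ζ j - toAmbient η j‖ ^ 2 :=
        (by gcongr : δ ^ 2 ≤ ‖toAmbient ζ j - toAmbient η j‖ ^ 2).trans
          (Finset.single_le_sum (f := fun j => ‖toAmbient ζ j - toAmbient η j‖ ^ 2)
            (fun _ _ => sq_nonneg _) (Finset.mem_univ j))
      have h4 : ‖ψ η - ψ ζ‖ ≤ 2 * M' := (norm_sub_le _ _).trans (by linarith [hM' η, hM' ζ])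
      have h5 : 2 * M' ≤ 2 * M' / δ ^ 2 * ∑ j, ‖toAmbient ζ j - toAmbient η j‖ ^ 2 := by
        rw [div_mul_eq_mul_div, le_div_iff₀ (by positivity)]
        gcongr
      linarith
  set K := 2 * M' / δ ^ 2 * (k * 2) with hK
  have hlim : Tendsto (fun r : ℝ => ε / 2 + K * (1 - r)) (𝓝[<] 1) (𝓝 (ε / 2 + K * (1 - 1))) :=
    (Continuous.tendsto (by fun_prop) 1).mono_left nhdsWithin_le_nhds
  have hev : ∀ᶠ r in 𝓝[<] (1 : ℝ), ε / 2 + K * (1 - r) < ε :=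
    hlim.eventually_lt_const (by linarith)
  filter_upwards [hev, Ioo_mem_nhdsLT (zero_lt_one' ℝ)] with r hrε hr
  refine ⟨hr, fun ζ => le_trans ?_ hrε.le⟩
  have hz := mem_domain_dilate hr ζ
  have hi1 := integrable_realPoisson_smul (ν := boundaryMeasure n) hz hψ
  have hi2 := integrable_realPoisson_smul (ν := boundaryMeasure n) hz
    (continuous_const (y := ψ ζ))
  have hsub : ∫ η, realPoisson (dilate r ζ) η • ψ η ∂boundaryMeasure n - ψ ζ =
      ∫ η, realPoisson (dilate r ζ) η • (ψ η - ψ ζ) ∂boundaryMeasure n := by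
    simp_rw [smul_sub]
    rw [integral_sub hi1 hi2, integral_smul_const, integral_realPoisson hz, one_smul]
  have hcj : ∀ j, Continuous fun η : DistBoundary n => ‖toAmbient ζ j - toAmbient η j‖ ^ 2 := by
    intro j
    have := continuous_toAmbient (n := n)
    fun_prop
  have hij : ∀ j, Integrable (fun η => realPoisson (dilate r ζ) η *
      ‖toAmbient ζ j - toAmbient η j‖ ^ 2) (boundaryMeasure n) := fun j =>
    integrable_realPoisson_smul hz (hcj j)
  have hip : Integrable (fun η => realPoisson (dilate r ζ) η) (boundaryMeasure n) := by
    simpa using integrable_realPoisson_smul (ν := boundaryMeasure n) hz (continuous_const (y := (1 : ℝ)))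
  have hbound : ∀ η, ‖realPoisson (dilate r ζ) η • (ψ η - ψ ζ)‖ ≤
      ε / 2 * realPoisson (dilate r ζ) η + 2 * M' / δ ^ 2 *
        ∑ j, realPoisson (dilate r ζ) η * ‖toAmbient ζ j - toAmbient η j‖ ^ 2 := by
    intro η
    rw [norm_smul, Real.norm_eq_abs, abs_of_nonneg (realPoisson_nonneg hz η), ← Finset.mul_sum]
    have := mul_le_mul_of_nonneg_left (hpt ζ η) (realPoisson_nonneg hz η)
    linarith
  have hib : Integrable (fun η => ε / 2 * realPoisson (dilate r ζ) η + 2 * M' / δ ^ 2 *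
        ∑ j, realPoisson (dilate r ζ) η * ‖toAmbient ζ j - toAmbient η j‖ ^ 2)
      (boundaryMeasure n) :=
    (hip.const_mul _).add ((integrable_finsetSum _ fun j _ => hij j).const_mul _)
  rw [hsub]
  refine (norm_integral_le_of_norm_le hib (ae_of_all _ hbound)).trans (le_of_eq ?_)
  rw [integral_add (hip.const_mul _) ((integrable_finsetSum _ fun j _ => hij j).const_mul _),
    integral_const_mul, integral_const_mul, integral_finsetSum _ fun j _ => hij j,
    integral_realPoisson hz]
  simp_rw [integral_realPoisson_mul_norm_sub_sq hr]
  simp [hK]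
  ring

/-- A finite measure is approximated, uniformly on measures of bounded mass, by its Poisson
integrals. -/
theorem eventually_norm_integral_sub_integral_poisson_le {ψ : DistBoundary n → ℂ}
    (hψ : Continuous ψ) {ε : ℝ} (hε : 0 < ε) :
    ∀ᶠ r in 𝓝[<] (1 : ℝ), r ∈ Ioo (0 : ℝ) 1 ∧
      ∀ (ν : Measure (DistBoundary n)) [IsFiniteMeasure ν],
        ‖∫ η, (∫ ζ, realPoisson (dilate r η) ζ ∂ν) • ψ η ∂boundaryMeasure n - ∫ ζ, ψ ζ ∂ν‖ ≤
          ε * ν.real univ := by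
  filter_upwards [eventually_norm_integral_realPoisson_sub_le hψ hε] with r ⟨hr, h⟩
  refine ⟨hr, fun ν _ => ?_⟩
  have hcont : Continuous (Function.uncurry fun η ζ : DistBoundary n =>
      realPoisson (dilate r η) ζ • ψ η) := by
    refine Continuous.smul (continuous_realPoisson ((continuous_dilate r).comp continuous_fst)
      continuous_snd fun p => mem_domain_dilate hr _) (hψ.comp continuous_fst)
  -- Fubini and the symmetry of the kernel put the smoothing on ψ, where the convergence is uniform.
  have hswap : ∫ η, (∫ ζ, realPoisson (dilate r η) ζ ∂ν) • ψ η ∂boundaryMeasure n =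
      ∫ ζ, ∫ η, realPoisson (dilate r ζ) η • ψ η ∂boundaryMeasure n ∂ν := by
    simp_rw [← integral_smul_const]
    rw [integral_integral_swap (integrable_of_continuous_of_compactSpace hcont)]
    simp_rw [fun ζ η : DistBoundary n => realPoisson_dilate_comm r η ζ]
  have hcont' : Continuous (Function.uncurry fun ζ η : DistBoundary n =>
      realPoisson (dilate r ζ) η • ψ η) := by
    refine Continuous.smul (continuous_realPoisson ((continuous_dilate r).comp continuous_fst)
      continuous_snd fun p => mem_domain_dilate hr _) (hψ.comp continuous_snd)
  have hi : Integrable (fun ζ => ∫ η, realPoisson (dilate r ζ) η • ψ η ∂boundaryMeasure n) ν :=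
    (integrable_of_continuous_of_compactSpace (μ := ν.prod (boundaryMeasure n)) hcont').integral_prod_left
  rw [hswap, ← integral_sub hi (integrable_of_continuous_of_compactSpace hψ)]
  exact norm_integral_le_of_norm_le_const (ae_of_all _ h)

/-- A finite measure is determined by its Poisson integral. -/
theorem measure_eq_of_integral_realPoisson_eq {ν ν' : Measure (DistBoundary n)} [IsFiniteMeasure ν]
    [IsFiniteMeasure ν']
    (h : ∀ z ∈ domain n, ∫ ζ, realPoisson z ζ ∂ν = ∫ ζ, realPoisson z ζ ∂ν') : ν = ν' := by
  refine ext_of_forall_integral_eq_of_IsFiniteMeasure fun f => ?_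
  have hψ : Continuous fun ζ => (f ζ : ℂ) := Complex.continuous_ofReal.comp f.continuous
  suffices ∫ ζ, (f ζ : ℂ) ∂ν = ∫ ζ, (f ζ : ℂ) ∂ν' by
    rw [integral_complex_ofReal, integral_complex_ofReal] at this
    exact_mod_cast this
  refine eq_of_forall_dist_le fun ε hε => ?_
  set m := ν.real univ + ν'.real univ + 1
  have hm0 : 0 ≤ ν.real univ := measureReal_nonneg
  have hm0' : 0 ≤ ν'.real univ := measureReal_nonneg
  have hm : 0 < m := by positivity
  obtain ⟨r, hr, hv⟩ := (eventually_norm_integral_sub_integral_poisson_le hψ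
    (div_pos hε hm)).exists
  have h1 := hv ν
  have h2 := hv ν'
  simp_rw [fun η => h _ (mem_domain_dilate hr η)] at h1
  rw [← dist_eq_norm] at h1 h2
  refine (dist_triangle_left _ _ _).trans ((add_le_add h1 h2).trans ?_)
  rw [← mul_add, div_mul_eq_mul_div, div_le_iff₀ hm]
  gcongr
  linarith

end Poisson

/-! ### The Poisson kernel of the disc as a function of α. -/

section Herglotz

theorem norm_unitCircle (α : UnitCircle) : ‖(α : ℂ)‖ = 1 := by simp

theorem unitCircle_sub_ne_zero (α : UnitCircle) {w : ℂ} (hw : ‖w‖ < 1) : (α : ℂ) - w ≠ 0 := by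
  intro h
  rw [← sub_eq_zero.1 h, norm_unitCircle] at hw
  exact lt_irrefl _ hw

/-- The function `Re ((α + w) / (α - w))`. -/
def herglotz (α : UnitCircle) (w : ℂ) : ℝ := (((α : ℂ) + w) / ((α : ℂ) - w)).re

theorem herglotz_eq_div (α : UnitCircle) (w : ℂ) :
    herglotz α w = (1 - ‖w‖ ^ 2) / ‖(α : ℂ) - w‖ ^ 2 := by
  have h1 : ‖(α : ℂ)‖ ^ 2 = 1 := by rw [norm_unitCircle, one_pow]
  rw [herglotz, Complex.div_re, ← add_div]
  simp only [← Complex.normSq_eq_norm_sq] at h1 ⊢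
  congr 1
  simp only [Complex.normSq_apply, Complex.add_re, Complex.sub_re, Complex.add_im,
    Complex.sub_im] at h1 ⊢
  linarith

theorem herglotz_pos (α : UnitCircle) {w : ℂ} (hw : ‖w‖ < 1) : 0 < herglotz α w := by
  rw [herglotz_eq_div]
  have := norm_pos_iff.2 (unitCircle_sub_ne_zero α hw)
  have h2 : ‖w‖ ^ 2 < 1 := pow_lt_one₀ (norm_nonneg _) hw two_ne_zero
  exact div_pos (by linarith) (by positivity)

theorem herglotz_le (α : UnitCircle) {w : ℂ} (hw : ‖w‖ < 1) :
    herglotz α w ≤ (1 - ‖w‖ ^ 2) / (1 - ‖w‖) ^ 2 := by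
  rw [herglotz_eq_div]
  have h2 : ‖w‖ ^ 2 < 1 := pow_lt_one₀ (norm_nonneg _) hw two_ne_zero
  have h3 : 1 - ‖w‖ ≤ ‖(α : ℂ) - w‖ := by
    simpa [norm_unitCircle] using norm_sub_norm_le (α : ℂ) w
  have h4 : 0 < 1 - ‖w‖ := by linarith
  have h5 : 0 ≤ 1 - ‖w‖ ^ 2 := by linarith
  gcongr

theorem continuous_herglotz {Y : Type*} [TopologicalSpace Y] {f : Y → UnitCircle} {g : Y → ℂ}
    (hf : Continuous f) (hg : Continuous g) (hgd : ∀ y, ‖g y‖ < 1) :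
    Continuous fun y => herglotz (f y) (g y) := by
  refine Complex.continuous_re.comp (Continuous.div (by fun_prop) (by fun_prop) fun y => ?_)
  exact unitCircle_sub_ne_zero _ (hgd y)

instance : IsProbabilityMeasure circleMeasure := by
  unfold circleMeasure; infer_instance

/-- The Poisson formula for the monomials in the unit disc. -/
theorem integral_circle_pow_mul_herglotz {w : ℂ} (hw : ‖w‖ < 1) (m : ℕ) :
    ∫ α : UnitCircle, (α : ℂ) ^ m * herglotz α w ∂circleMeasure = w ^ m := by
  -- The same device as in several variables: on the circle the Cauchy kernel at w times H is x^m
  -- times the Poisson kernel, and H(w) = w^m.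
  let H : ℂ → ℂ := fun x => x ^ m * (1 - conj w * x)⁻¹ * (1 - conj w * w)
  have hw0 := norm_nonneg w
  have hd : DifferentiableOn ℂ H (Metric.ball 0 (2 / (1 + ‖w‖))) := by
    have h1 : DifferentiableOn ℂ (fun x => (1 - conj w * x)) (Metric.ball 0 (2 / (1 + ‖w‖))) :=
      Differentiable.differentiableOn (by fun_prop)
    refine DifferentiableOn.mul_const (DifferentiableOn.fun_mul
      (Differentiable.differentiableOn (by fun_prop)) (h1.fun_inv fun x hx => ?_)) _
    refine one_sub_ne_zero_of_norm_lt_one ?_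
    rw [mem_ball_zero_iff, lt_div_iff₀ (by linarith)] at hx
    rw [norm_mul, RCLike.norm_conj]
    nlinarith [norm_nonneg x]
  have h := integral_sphere_cauchy (V := ℂ) (by rw [lt_div_iff₀ (by linarith)]; linarith) hd hw
  have hne : ∀ x : ℂ, ‖x‖ ≤ 1 → 1 - conj w * x ≠ 0 := by
    intro x hx
    refine one_sub_ne_zero_of_norm_lt_one ?_
    rw [norm_mul, RCLike.norm_conj]
    nlinarith
  have hH : H w = w ^ m := by
    simp only [H]
    rw [mul_assoc, inv_mul_cancel₀ (hne w hw.le), mul_one]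
  rw [← hH, ← h, circleMeasure]
  refine integral_congr_ae (ae_of_all _ fun α => ?_)
  simp only [Module.finrank_self, pow_one, H]
  have hα : (α : ℂ) * conj (α : ℂ) = 1 := by
    rw [Complex.mul_conj, Complex.normSq_eq_norm_sq, norm_unitCircle]; simp
  have hα0 : (α : ℂ) ≠ 0 := left_ne_zero_of_mul_eq_one hα
  have hin : inner ℂ (α : ℂ) w = w * conj (α : ℂ) := by simp
  have h3 : (1 : ℂ) - w * conj (α : ℂ) = ((α : ℂ) - w) * conj (α : ℂ) := by
    rw [sub_mul, hα]
  have h4 : (1 : ℂ) - conj w * α = conj ((α : ℂ) - w) * α := by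
    rw [map_sub, sub_mul, mul_comm (conj (α : ℂ)), hα]
  have h5 : (((herglotz α w : ℝ) : ℂ)) =
      (1 - conj w * w) * (((α : ℂ) - w) * conj ((α : ℂ) - w))⁻¹ := by
    rw [herglotz_eq_div, Complex.mul_conj, Complex.normSq_eq_norm_sq, mul_comm (conj w),
      Complex.mul_conj, Complex.normSq_eq_norm_sq, div_eq_mul_inv]
    push_cast
    rfl
  rw [hin, h5, h3, h4, one_div, mul_inv, mul_inv, mul_inv]
  have h6 : (conj (α : ℂ))⁻¹ * (α : ℂ)⁻¹ = 1 := by rw [← mul_inv, mul_comm, hα, inv_one]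
  linear_combination (-((α : ℂ) ^ m * (1 - conj w * w) * ((α : ℂ) - w)⁻¹ *
    (conj ((α : ℂ) - w))⁻¹)) * h6

theorem integral_circle_herglotz {w : ℂ} (hw : ‖w‖ < 1) :
    ∫ α : UnitCircle, herglotz α w ∂circleMeasure = 1 := by
  have h := integral_circle_pow_mul_herglotz hw 0
  simp only [pow_zero, one_mul] at h
  rw [integral_complex_ofReal] at h
  exact_mod_cast h

end Herglotz

/-! ### Clark measures: existence, uniqueness and dependence on α. -/

section Clark

variable {k : ℕ} {n : Fin k → ℕ} {I : Ambient n → ℂ}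

theorem IsInner.differentiableOn_herglotz (hI : IsInner I) (α : UnitCircle) :
    DifferentiableOn ℂ (fun z => ((α : ℂ) + I z) / ((α : ℂ) - I z)) (domain n) := by
  have h1 := hI.holomorphic
  have h2 : DifferentiableOn ℂ (fun z => (α : ℂ) - I z) (domain n) :=
    (differentiableOn_const _).sub h1
  have h3 : DifferentiableOn ℂ (fun z => (α : ℂ) + I z) (domain n) :=
    (differentiableOn_const _).add h1
  simp only [div_eq_mul_inv]
  exact h3.fun_mul (h2.fun_inv fun z hz => unitCircle_sub_ne_zero α (hI.norm_lt_one z hz))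

theorem isClarkMeasure_iff {α : UnitCircle} {σ : Measure (DistBoundary n)} :
    IsClarkMeasure I α σ ↔ IsFiniteMeasure σ ∧
      ∀ z ∈ domain n, ∫ ζ, realPoisson z ζ ∂σ = herglotz α (I z) := by
  have key : ∀ z, ∫ ζ, poissonKernel z ζ ∂σ = ((((α : ℂ) + I z) / ((α : ℂ) - I z)).re : ℂ) ↔
      ∫ ζ, realPoisson z ζ ∂σ = herglotz α (I z) := by
    intro z
    simp only [poissonKernel_eq_realPoisson]
    rw [integral_complex_ofReal]
    exact Complex.ofReal_inj
  exact ⟨fun h => ⟨h.1, fun z hz => (key z).1 (h.2 z hz)⟩,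
    fun h => ⟨h.1, fun z hz => (key z).2 (h.2 z hz)⟩⟩

theorem IsInner.continuous_herglotz_dilate (hI : IsInner I) {r : ℝ} (hr : r ∈ Ioo (0 : ℝ) 1) :
    Continuous fun p : UnitCircle × DistBoundary n => herglotz p.1 (I (dilate r p.2)) :=
  continuous_herglotz continuous_fst ((continuous_comp_dilate hI.holomorphic hr).comp continuous_snd)
    fun _ => hI.norm_lt_one _ (mem_domain_dilate hr _)

variable [∀ j, NeZero (n j)]

theorem IsInner.integral_realPoisson_mul_herglotz (hI : IsInner I) (α : UnitCircle) {z : Ambient n}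
    (hz : z ∈ domain n) {r : ℝ} (hr : r ∈ Ioo (0 : ℝ) 1) :
    ∫ ζ, realPoisson z ζ * herglotz α (I (dilate r ζ)) ∂boundaryMeasure n =
      herglotz α (I (r • z)) :=
  integral_realPoisson_mul_re_dilate (hI.differentiableOn_herglotz α) hz hr

/-- The functions Re((α + I)/(α - I)) on dilated boundaries, divided by their common mean c, are
probability densities; a weak limit of these, multiplied by c, has the required Poisson integral. -/
theorem IsInner.exists_isClarkMeasure (hI : IsInner I) (α : UnitCircle) :
    ∃ σ : Measure (DistBoundary n), IsClarkMeasure I α σ := by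
  set c := herglotz α (I 0) with hc
  have hc0 : 0 < c := herglotz_pos α (hI.norm_lt_one 0 zero_mem_domain)
  -- The shift by 2 keeps the radius positive already for m = 0.
  let ρ : ℕ → ℝ := fun m => 1 - 1 / ((m : ℝ) + 2)
  have hρ : ∀ m, ρ m ∈ Ioo (0 : ℝ) 1 := by
    intro m
    have h1 : (0 : ℝ) < (m : ℝ) + 2 := by positivity
    refine ⟨?_, ?_⟩
    · simp only [ρ]; rw [sub_pos, div_lt_one h1]; linarith [(Nat.cast_nonneg m : (0 : ℝ) ≤ m)]
    · simp only [ρ]; linarith [one_div_pos.2 h1]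
  have hρlim : Tendsto ρ atTop (𝓝 1) := by
    have h1 : Tendsto (fun m : ℕ => 1 / ((m : ℝ) + 2)) atTop (𝓝 0) :=
      tendsto_const_nhds.div_atTop (tendsto_atTop_add_const_right _ _ tendsto_natCast_atTop_atTop)
    have h2 := (tendsto_const_nhds (x := (1 : ℝ))).sub h1
    rwa [sub_zero] at h2
  let u : ℕ → DistBoundary n → ℝ := fun m ζ => herglotz α (I (dilate (ρ m) ζ)) / c
  have hu0 : ∀ m ζ, 0 ≤ u m ζ := fun m ζ =>
    div_nonneg (herglotz_pos α (hI.norm_lt_one _ (mem_domain_dilate (hρ m) ζ))).le hc0.le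
  have huc : ∀ m, Continuous (u m) := fun m =>
    (continuous_herglotz continuous_const (continuous_comp_dilate hI.holomorphic (hρ m))
      fun ζ => hI.norm_lt_one _ (mem_domain_dilate (hρ m) ζ)).div_const _
  have hint : ∀ m, ∀ f : DistBoundary n → ℝ,
      ∫ ζ, f ζ ∂(boundaryMeasure n).withDensity (fun ζ => ENNReal.ofReal (u m ζ)) =
      ∫ ζ, u m ζ * f ζ ∂boundaryMeasure n := by
    intro m f
    have h := integral_withDensity_eq_integral_smul (μ := boundaryMeasure n)
      (f := fun ζ => (u m ζ).toNNReal) (huc m).measurable.real_toNNReal f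
    refine h.trans (integral_congr_ae (ae_of_all _ fun ζ => ?_))
    simp [NNReal.smul_def, Real.coe_toNNReal _ (hu0 m ζ)]
  have hP : ∀ m, ∀ z ∈ domain n, ∫ ζ, u m ζ * realPoisson z ζ ∂boundaryMeasure n =
      herglotz α (I (ρ m • z)) / c := by
    intro m z hz
    rw [← hI.integral_realPoisson_mul_herglotz α hz (hρ m), ← integral_div]
    refine integral_congr_ae (ae_of_all _ fun ζ => ?_)
    simp only [u]; ring
  have hprob : ∀ m, IsProbabilityMeasure
      ((boundaryMeasure n).withDensity (fun ζ => ENNReal.ofReal (u m ζ))) := by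
    intro m
    refine ⟨?_⟩
    rw [withDensity_apply _ MeasurableSet.univ, Measure.restrict_univ,
      ← ofReal_integral_eq_lintegral_ofReal (integrable_of_continuous_of_compactSpace (huc m))
        (ae_of_all _ (hu0 m))]
    have := hP m 0 zero_mem_domain
    simp only [realPoisson_zero, mul_one, smul_zero] at this
    rw [this, ← hc, div_self hc0.ne', ENNReal.ofReal_one]
  let p : ℕ → ProbabilityMeasure (DistBoundary n) := fun m => ⟨_, hprob m⟩
  -- An ultrafilter finer than `atTop` converges in the compact space of probability measures, so no
  -- subsequence is needed.
  let 𝓤 := Ultrafilter.of (atTop : Filter ℕ)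
  obtain ⟨ν, -, hν⟩ := (isCompact_univ (X := ProbabilityMeasure (DistBoundary n))).ultrafilter_le_nhds
    (𝓤.map p) (by simp)
  have hν' : Tendsto p 𝓤 (𝓝 ν) := hν
  rw [ProbabilityMeasure.tendsto_iff_forall_integral_tendsto] at hν'
  refine ⟨ENNReal.ofReal c • (ν : Measure (DistBoundary n)), isClarkMeasure_iff.2
    ⟨(ν : Measure (DistBoundary n)).smul_finite ENNReal.ofReal_ne_top, fun z hz => ?_⟩⟩
  have h1 := hν' (BoundedContinuousFunction.mkOfCompact ⟨fun ζ => realPoisson z ζ,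
    continuous_realPoisson continuous_const continuous_id fun _ => hz⟩)
  simp only [BoundedContinuousFunction.mkOfCompact_apply, ContinuousMap.coe_mk] at h1
  have h2 : ∀ m, ∫ ζ, realPoisson z ζ ∂(p m : Measure (DistBoundary n)) =
      herglotz α (I (ρ m • z)) / c := fun m => (hint m _).trans (hP m z hz)
  simp_rw [h2] at h1
  have h3 : Tendsto (fun m => herglotz α (I (ρ m • z)) / c) atTop (𝓝 (herglotz α (I z) / c)) := by
    have hopen : IsOpen (domain n) := by
      have : domain n = ⋂ j, {z : Ambient n | ‖z j‖ < 1} := by ext; simp [domain]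
      rw [this]
      exact isOpen_iInter_of_finite fun j => isOpen_lt (by fun_prop) continuous_const
    have h4 : ContinuousAt (fun z => ((α : ℂ) + I z) / ((α : ℂ) - I z)) z :=
      (hI.differentiableOn_herglotz α).continuousOn.continuousAt (hopen.mem_nhds hz)
    have h5 : Tendsto (fun m => ρ m • z) atTop (𝓝 z) := by
      simpa using hρlim.smul_const z
    exact ((Complex.continuous_re.tendsto _).comp (h4.tendsto.comp h5)).div_const c
  have h4 := tendsto_nhds_unique h1 (h3.mono_left (Ultrafilter.of_le _))
  rw [integral_smul_measure, h4, ENNReal.toReal_ofReal hc0.le, smul_eq_mul, mul_div_cancel₀ _ hc0.ne']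

theorem IsClarkMeasure.unique {α : UnitCircle} {σ σ' : Measure (DistBoundary n)}
    (h : IsClarkMeasure I α σ) (h' : IsClarkMeasure I α σ') : σ = σ' := by
  obtain ⟨hf, hp⟩ := isClarkMeasure_iff.1 h
  obtain ⟨hf', hp'⟩ := isClarkMeasure_iff.1 h'
  exact measure_eq_of_integral_realPoisson_eq fun z hz => (hp z hz).trans (hp' z hz).symm

theorem IsInner.isClarkMeasure_clarkMeasure (hI : IsInner I) (α : UnitCircle) :
    IsClarkMeasure I α (clarkMeasure I α) := by
  have h := hI.exists_isClarkMeasure α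
  rw [clarkMeasure, dif_pos h]
  exact h.choose_spec

theorem IsInner.isFiniteMeasure_clarkMeasure (hI : IsInner I) (α : UnitCircle) :
    IsFiniteMeasure (clarkMeasure I α) :=
  (hI.isClarkMeasure_clarkMeasure α).finite

theorem IsInner.integral_realPoisson_clarkMeasure (hI : IsInner I) (α : UnitCircle) {z : Ambient n}
    (hz : z ∈ domain n) : ∫ ζ, realPoisson z ζ ∂clarkMeasure I α = herglotz α (I z) :=
  (isClarkMeasure_iff.1 (hI.isClarkMeasure_clarkMeasure α)).2 z hz

theorem IsInner.measureReal_clarkMeasure_univ (hI : IsInner I) (α : UnitCircle) :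
    (clarkMeasure I α).real univ = herglotz α (I 0) := by
  rw [← hI.integral_realPoisson_clarkMeasure α zero_mem_domain]
  simp [realPoisson_zero]

/-- Bounded masses make the Poisson approximation uniform in α and the family σ_α a finite kernel.
-/
theorem IsInner.exists_measureReal_clarkMeasure_le (hI : IsInner I) :
    ∃ M : ℝ, 0 < M ∧ ∀ α, (clarkMeasure I α).real univ ≤ M := by
  refine ⟨max ((1 - ‖I 0‖ ^ 2) / (1 - ‖I 0‖) ^ 2) 1, by positivity, fun α => ?_⟩
  rw [hI.measureReal_clarkMeasure_univ]
  exact (herglotz_le α (hI.norm_lt_one 0 zero_mem_domain)).trans (le_max_left _ _)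

/-- Uniform approximation of the integrals with respect to the Clark measures. -/
theorem IsInner.eventually_norm_integral_sub_le (hI : IsInner I) {ψ : DistBoundary n → ℂ}
    (hψ : Continuous ψ) {ε : ℝ} (hε : 0 < ε) :
    ∀ᶠ r in 𝓝[<] (1 : ℝ), r ∈ Ioo (0 : ℝ) 1 ∧ ∀ α : UnitCircle,
      ‖∫ η, herglotz α (I (dilate r η)) • ψ η ∂boundaryMeasure n - ∫ ζ, ψ ζ ∂clarkMeasure I α‖ ≤ ε := by
  obtain ⟨M, hM, hMα⟩ := hI.exists_measureReal_clarkMeasure_le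
  filter_upwards [eventually_norm_integral_sub_integral_poisson_le hψ (div_pos hε hM)]
    with r ⟨hr, h⟩
  refine ⟨hr, fun α => ?_⟩
  have := hI.isFiniteMeasure_clarkMeasure α
  have h1 := h (clarkMeasure I α)
  simp_rw [fun η => hI.integral_realPoisson_clarkMeasure α (mem_domain_dilate hr η)] at h1
  refine h1.trans ?_
  rw [div_mul_eq_mul_div, div_le_iff₀ hM]
  gcongr
  exact hMα α

/-- A uniform limit, as r → 1, of functions that are visibly continuous in α. -/
theorem IsInner.continuous_integral_clarkMeasure (hI : IsInner I) {ψ : DistBoundary n → ℂ}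
    (hψ : Continuous ψ) : Continuous fun α => ∫ ζ, ψ ζ ∂clarkMeasure I α := by
  refine continuous_of_uniform_approx_of_continuous fun U hU => ?_
  obtain ⟨ε, hε, hεU⟩ := Metric.mem_uniformity_dist.1 hU
  obtain ⟨r, hr, h⟩ := (hI.eventually_norm_integral_sub_le hψ (half_pos hε)).exists
  refine ⟨fun α => ∫ η, herglotz α (I (dilate r η)) • ψ η ∂boundaryMeasure n, ?_, fun α => ?_⟩
  · have hc : Continuous (Function.uncurry fun (α : UnitCircle) (η : DistBoundary n) =>
        herglotz α (I (dilate r η)) • ψ η) :=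
      (hI.continuous_herglotz_dilate hr).smul (hψ.comp continuous_snd)
    simpa using continuous_parametric_integral_of_continuous (μ := boundaryMeasure n) hc
      isCompact_univ
  · refine hεU ?_
    rw [dist_comm, dist_eq_norm]
    exact (h α).trans_lt (half_lt_self hε)

/-- Indicators of closed sets are limits of continuous functions, whose integrals are continuous in
α; closed sets form a π-system generating the Borel sets. -/
theorem IsInner.measurable_clarkMeasure (hI : IsInner I) : Measurable (clarkMeasure I) := by
  have := hI.isFiniteMeasure_clarkMeasure
  have hcl : ∀ F : Set (DistBoundary n), IsClosed F → Measurable fun α => clarkMeasure I α F := by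
    intro F hF
    refine measurable_of_tendsto_metrizable (f := fun m α => ∫⁻ x, hF.apprSeq m x ∂clarkMeasure I α)
      (fun m => ?_) (tendsto_pi_nhds.2 fun α => HasOuterApproxClosed.tendsto_lintegral_apprSeq hF _)
    have hc : Continuous fun ζ => ((hF.apprSeq m ζ : ℝ) : ℂ) := by fun_prop
    have h1 : ∀ α, ∫⁻ x, hF.apprSeq m x ∂clarkMeasure I α =
        ENNReal.ofReal (∫ ζ, ((hF.apprSeq m ζ : ℝ) : ℂ) ∂clarkMeasure I α).re := by
      intro α
      rw [integral_complex_ofReal, Complex.ofReal_re, ofReal_integral_eq_lintegral_ofReal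
        (integrable_of_continuous_of_compactSpace (by fun_prop)) (ae_of_all _ fun ζ => NNReal.coe_nonneg _)]
      simp
    simp_rw [h1]
    exact (Complex.measurable_re.comp (hI.continuous_integral_clarkMeasure hc).measurable).ennreal_ofReal
  refine Measurable.measure_of_isPiSystem (S := {s | IsClosed s}) ?_ isPiSystem_isClosed
    (fun F hF => hcl F hF) (hcl _ isClosed_univ)
  rw [← borel_eq_generateFrom_isClosed, BorelSpace.measurable_eq (α := DistBoundary n)]

end Clark

/-! ### Disintegration of Σ and the moments of α ↦ ∫ φ dσ_α. -/

section Disintegration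

open ProbabilityTheory

variable {k : ℕ} {n : Fin k → ℕ} {I : Ambient n → ℂ} [∀ j, NeZero (n j)]

/-- The Clark measures as a kernel. -/
def IsInner.clarkKernel (hI : IsInner I) : Kernel UnitCircle (DistBoundary n) :=
  ⟨clarkMeasure I, hI.measurable_clarkMeasure⟩

theorem IsInner.clarkKernel_apply (hI : IsInner I) (α : UnitCircle) :
    hI.clarkKernel α = clarkMeasure I α := rfl

theorem IsInner.isFiniteKernel_clarkKernel (hI : IsInner I) : IsFiniteKernel hI.clarkKernel := by
  obtain ⟨M, hM, h⟩ := hI.exists_measureReal_clarkMeasure_le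
  refine ⟨ENNReal.ofReal M, ENNReal.ofReal_lt_top, fun α => ?_⟩
  have := hI.isFiniteMeasure_clarkMeasure α
  rw [hI.clarkKernel_apply, ← ofReal_measureReal]
  exact ENNReal.ofReal_le_ofReal (h α)

theorem integrable_integral_bind {X Y E : Type*} {_ : MeasurableSpace X} {_ : MeasurableSpace Y}
    [NormedAddCommGroup E] [NormedSpace ℝ E] {μ : Measure X} {κ : Kernel X Y} {f : Y → E}
    (hf : Integrable f (μ.bind κ)) : Integrable (fun x => ∫ y, f y ∂κ x) μ := by
  rw [Measure.comp_eq_comp_const_apply] at hf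
  exact hf.integral_comp

theorem integral_bind_kernel {X Y E : Type*} {_ : MeasurableSpace X} {_ : MeasurableSpace Y}
    [NormedAddCommGroup E] [NormedSpace ℝ E] {μ : Measure X} {κ : Kernel X Y} {f : Y → E}
    (hf : Integrable f (μ.bind κ)) : ∫ y, f y ∂μ.bind κ = ∫ x, ∫ y, f y ∂κ x ∂μ := by
  rw [Measure.comp_eq_comp_const_apply] at hf ⊢
  rw [Kernel.integral_comp hf, Kernel.const_apply]

theorem ae_integrable_of_integrable_bind {X Y E : Type*} {_ : MeasurableSpace X}
    {_ : MeasurableSpace Y} [NormedAddCommGroup E] {μ : Measure X} {κ : Kernel X Y} {f : Y → E}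
    (hf : Integrable f (μ.bind κ)) : ∀ᵐ x ∂μ, Integrable f (κ x) := by
  rw [Measure.comp_eq_comp_const_apply] at hf
  simpa using hf.ae_of_comp

/-- The disintegration of the measure `Σ` into Clark measures. -/
theorem IsInner.bind_clarkKernel (hI : IsInner I) :
    circleMeasure.bind hI.clarkKernel = boundaryMeasure n := by
  have := hI.isFiniteKernel_clarkKernel
  -- Both measures have Poisson integral 1, on the left because Re((α + w)/(α - w)) has mean 1 in α.
  refine measure_eq_of_integral_realPoisson_eq fun z hz => ?_
  have hi : Integrable (fun ζ => realPoisson z ζ) (circleMeasure.bind hI.clarkKernel) :=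
    integrable_of_continuous_of_compactSpace
      (continuous_realPoisson continuous_const continuous_id fun _ => hz)
  rw [integral_realPoisson hz, integral_bind_kernel hi]
  simp_rw [hI.clarkKernel_apply, fun α => hI.integral_realPoisson_clarkMeasure α hz]
  exact integral_circle_herglotz (hI.norm_lt_one z hz)

theorem IsInner.ae_ae_clarkMeasure (hI : IsInner I) {p : DistBoundary n → Prop}
    (h : ∀ᵐ ζ ∂boundaryMeasure n, p ζ) : ∀ᵐ α ∂circleMeasure, ∀ᵐ ζ ∂clarkMeasure I α, p ζ := by
  rw [← hI.bind_clarkKernel] at h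
  exact Measure.ae_ae_of_ae_bind hI.measurable_clarkMeasure.aemeasurable h

variable {E : Type*} [NormedAddCommGroup E]

theorem IsInner.ae_integrable_clarkMeasure (hI : IsInner I) {φ : DistBoundary n → E}
    (h : Integrable φ (boundaryMeasure n)) :
    ∀ᵐ α ∂circleMeasure, Integrable φ (clarkMeasure I α) := by
  rw [← hI.bind_clarkKernel] at h
  have h1 := ae_integrable_of_integrable_bind (κ := hI.clarkKernel) h
  simpa only [hI.clarkKernel_apply] using h1

variable [NormedSpace ℝ E]

theorem IsInner.integrable_integral_clarkMeasure (hI : IsInner I) {φ : DistBoundary n → E}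
    (h : Integrable φ (boundaryMeasure n)) :
    Integrable (fun α => ∫ ζ, φ ζ ∂clarkMeasure I α) circleMeasure := by
  rw [← hI.bind_clarkKernel] at h
  exact integrable_integral_bind h

theorem IsInner.integral_integral_clarkMeasure (hI : IsInner I) {φ : DistBoundary n → E}
    (h : Integrable φ (boundaryMeasure n)) :
    ∫ α, ∫ ζ, φ ζ ∂clarkMeasure I α ∂circleMeasure = ∫ ζ, φ ζ ∂boundaryMeasure n := by
  rw [← hI.bind_clarkKernel] at h
  conv_rhs => rw [← hI.bind_clarkKernel]
  exact (integral_bind_kernel h).symm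

omit [∀ j, NeZero (n j)] in
theorem IsInner.exists_boundary_function (hI : IsInner I) :
    ∃ J : DistBoundary n → ℂ, AEStronglyMeasurable J (boundaryMeasure n) ∧
      ∀ᵐ ζ ∂boundaryMeasure n, HasRadialLimit I ζ (J ζ) ∧ ‖J ζ‖ = 1 := by
  classical
  have hex : ∃ J : DistBoundary n → ℂ,
      ∀ᵐ ζ ∂boundaryMeasure n, HasRadialLimit I ζ (J ζ) ∧ ‖J ζ‖ = 1 := by
    refine ⟨fun ζ => if h : ∃ w : ℂ, HasRadialLimit I ζ w ∧ ‖w‖ = 1 then h.choose else 0, ?_⟩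
    filter_upwards [hI.unimodular] with ζ h
    rw [dif_pos h]
    exact h.choose_spec
  obtain ⟨J, hJ⟩ := hex
  refine ⟨J, ?_, hJ⟩
  -- The dilates are continuous only for r in (0, 1); the default value 0 elsewhere makes every
  -- member of the family measurable and does not affect the limit.
  refine aestronglyMeasurable_of_tendsto_ae (𝓝[<] (1 : ℝ))
    (f := fun r ζ => if r ∈ Ioo (0 : ℝ) 1 then I (dilate r ζ) else 0) (fun r => ?_) ?_
  · by_cases hr : r ∈ Ioo (0 : ℝ) 1
    · simp only [hr, if_true]
      exact (continuous_comp_dilate hI.holomorphic hr).aestronglyMeasurable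
    · simp only [hr, if_false]
      exact aestronglyMeasurable_const
  · filter_upwards [hJ] with ζ h
    refine h.1.congr' ?_
    filter_upwards [Ioo_mem_nhdsLT (zero_lt_one' ℝ)] with r hr
    rw [if_pos hr]

variable {J : DistBoundary n → ℂ}

/-- Both sides are limits, as r → 1, of ∫ I(rη)^m ψ(η) dΣ(η): one by dominated convergence, the
other by the Poisson formula in the disc and the approximation of σ_α that is uniform in α. -/
theorem IsInner.integral_pow_mul_integral_clarkMeasure_of_continuous (hI : IsInner I)
    (hJ : ∀ᵐ ζ ∂boundaryMeasure n, HasRadialLimit I ζ (J ζ) ∧ ‖J ζ‖ = 1)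
    {ψ : DistBoundary n → ℂ} (hψ : Continuous ψ) (m : ℕ) :
    ∫ α : UnitCircle, (α : ℂ) ^ m * ∫ ζ, ψ ζ ∂clarkMeasure I α ∂circleMeasure =
      ∫ ζ, J ζ ^ m * ψ ζ ∂boundaryMeasure n := by
  obtain ⟨M, hM⟩ := isCompact_univ.exists_bound_of_continuousOn hψ.continuousOn
  have hA : ∀ r ∈ Ioo (0 : ℝ) 1, ∫ α : UnitCircle, (α : ℂ) ^ m *
      ∫ η, herglotz α (I (dilate r η)) • ψ η ∂boundaryMeasure n ∂circleMeasure =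
      ∫ η, I (dilate r η) ^ m * ψ η ∂boundaryMeasure n := by
    intro r hr
    have hc : Continuous (Function.uncurry fun (α : UnitCircle) (η : DistBoundary n) =>
        (α : ℂ) ^ m * (herglotz α (I (dilate r η)) • ψ η)) := by
      have h1 := hI.continuous_herglotz_dilate hr
      refine Continuous.mul (by fun_prop) (h1.smul (hψ.comp continuous_snd))
    simp_rw [← integral_const_mul]
    rw [integral_integral_swap (integrable_of_continuous_of_compactSpace hc)]
    refine integral_congr_ae (ae_of_all _ fun η => ?_)
    simp only
    rw [← integral_circle_pow_mul_herglotz (hI.norm_lt_one _ (mem_domain_dilate hr η)),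
      ← integral_mul_const]
    refine integral_congr_ae (ae_of_all _ fun α => ?_)
    simp only [Complex.real_smul]
    ring
  have h1 : Tendsto (fun r => ∫ η, I (dilate r η) ^ m * ψ η ∂boundaryMeasure n) (𝓝[<] 1)
      (𝓝 (∫ ζ, J ζ ^ m * ψ ζ ∂boundaryMeasure n)) := by
    refine tendsto_integral_filter_of_dominated_convergence (fun _ => M) ?_ ?_
      (integrable_const _) ?_
    · filter_upwards [Ioo_mem_nhdsLT (zero_lt_one' ℝ)] with r hr
      exact (((continuous_comp_dilate hI.holomorphic hr).pow m).mul hψ).aestronglyMeasurable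
    · filter_upwards [Ioo_mem_nhdsLT (zero_lt_one' ℝ)] with r hr
      refine ae_of_all _ fun ζ => ?_
      rw [norm_mul, norm_pow]
      exact (mul_le_of_le_one_left (norm_nonneg _) (pow_le_one₀ (norm_nonneg _)
        (hI.norm_lt_one _ (mem_domain_dilate hr ζ)).le)).trans (hM ζ (mem_univ _))
    · filter_upwards [hJ] with ζ h
      exact (h.1.pow m).mul_const _
  have h2 : Tendsto (fun r => ∫ η, I (dilate r η) ^ m * ψ η ∂boundaryMeasure n) (𝓝[<] 1)
      (𝓝 (∫ α : UnitCircle, (α : ℂ) ^ m * ∫ ζ, ψ ζ ∂clarkMeasure I α ∂circleMeasure)) := by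
    rw [Metric.tendsto_nhds]
    intro ε hε
    filter_upwards [hI.eventually_norm_integral_sub_le hψ (half_pos hε)] with r ⟨hr, h⟩
    have hc : Continuous (Function.uncurry fun (α : UnitCircle) (η : DistBoundary n) =>
        herglotz α (I (dilate r η)) • ψ η) :=
      (hI.continuous_herglotz_dilate hr).smul (hψ.comp continuous_snd)
    have hc' := continuous_parametric_integral_of_continuous (μ := boundaryMeasure n) hc
      isCompact_univ
    simp only [Measure.restrict_univ] at hc'
    have hcσ := hI.continuous_integral_clarkMeasure hψ
    rw [← hA r hr, dist_eq_norm, ← integral_sub]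
    · refine lt_of_le_of_lt ?_ (half_lt_self hε)
      have : ∫ _ : UnitCircle, ε / 2 ∂circleMeasure = ε / 2 := by simp
      rw [← this]
      refine norm_integral_le_of_norm_le (integrable_const _) (ae_of_all _ fun α => ?_)
      rw [← mul_sub, norm_mul, norm_pow, norm_unitCircle, one_pow, one_mul]
      exact h α
    · exact integrable_of_continuous_of_compactSpace (by fun_prop)
    · exact integrable_of_continuous_of_compactSpace (by fun_prop)
  exact tendsto_nhds_unique h2 h1

theorem norm_integral_mul_le_of_norm_eq_one {X : Type*} {_ : MeasurableSpace X} {μ : Measure X}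
    {a f : X → ℂ} {g : X → ℝ} (ha : ∀ᵐ x ∂μ, ‖a x‖ = 1) (hg : Integrable g μ)
    (hfg : ∀ᵐ x ∂μ, ‖f x‖ ≤ g x) : ‖∫ x, a x * f x ∂μ‖ ≤ ∫ x, g x ∂μ := by
  refine norm_integral_le_of_norm_le hg ?_
  filter_upwards [ha, hfg] with x h1 h2
  rwa [norm_mul, h1, one_mul]

/-- Continuous functions are dense in L¹(Σ), and both sides are bounded by the L¹ norm of φ: the
left by the disintegration, the right by |J| = 1. -/
theorem IsInner.integral_pow_mul_integral_clarkMeasure (hI : IsInner I)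
    (hJm : AEStronglyMeasurable J (boundaryMeasure n))
    (hJ : ∀ᵐ ζ ∂boundaryMeasure n, HasRadialLimit I ζ (J ζ) ∧ ‖J ζ‖ = 1)
    {φ : DistBoundary n → ℂ} (hφ : Integrable φ (boundaryMeasure n)) (m : ℕ) :
    ∫ α : UnitCircle, (α : ℂ) ^ m * ∫ ζ, φ ζ ∂clarkMeasure I α ∂circleMeasure =
      ∫ ζ, J ζ ^ m * φ ζ ∂boundaryMeasure n := by
  refine eq_of_forall_dist_le fun ε hε => ?_
  obtain ⟨ψ, hψε, hψi⟩ := hφ.exists_boundedContinuous_integral_sub_le (half_pos hε)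
  have hJ1 : ∀ᵐ ζ ∂boundaryMeasure n, ‖J ζ ^ m‖ = 1 := by
    filter_upwards [hJ] with ζ h
    rw [norm_pow, h.2, one_pow]
  have hα1 : ∀ α : UnitCircle, ‖(α : ℂ) ^ m‖ = 1 := fun α => by
    rw [norm_pow, norm_unitCircle, one_pow]
  have hαm : AEStronglyMeasurable (fun α : UnitCircle => (α : ℂ) ^ m) circleMeasure :=
    Continuous.aestronglyMeasurable (by fun_prop)
  have hsub : Integrable (fun ζ => φ ζ - ψ ζ) (boundaryMeasure n) := hφ.sub hψi
  have hL : ‖∫ α : UnitCircle, (α : ℂ) ^ m * ∫ ζ, φ ζ ∂clarkMeasure I α ∂circleMeasure -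
      ∫ α : UnitCircle, (α : ℂ) ^ m * ∫ ζ, ψ ζ ∂clarkMeasure I α ∂circleMeasure‖ ≤ ε / 2 := by
    rw [← integral_sub ((hI.integrable_integral_clarkMeasure hφ).bdd_mul hαm
        (ae_of_all _ fun α => (hα1 α).le)) ((hI.integrable_integral_clarkMeasure hψi).bdd_mul hαm
        (ae_of_all _ fun α => (hα1 α).le))]
    simp_rw [← mul_sub]
    refine (norm_integral_mul_le_of_norm_eq_one (ae_of_all _ hα1)
      (hI.integrable_integral_clarkMeasure hsub.norm) ?_).trans
      ((hI.integral_integral_clarkMeasure hsub.norm).le.trans hψε)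
    filter_upwards [hI.ae_integrable_clarkMeasure hφ, hI.ae_integrable_clarkMeasure hψi]
      with α h1 h2
    rw [← integral_sub h1 h2]
    exact norm_integral_le_integral_norm _
  have hR : ‖∫ ζ, J ζ ^ m * φ ζ ∂boundaryMeasure n - ∫ ζ, J ζ ^ m * ψ ζ ∂boundaryMeasure n‖ ≤
      ε / 2 := by
    have hb : ∀ᵐ ζ ∂boundaryMeasure n, ‖J ζ ^ m‖ ≤ 1 := hJ1.mono fun ζ h => h.le
    have hJm' : AEStronglyMeasurable (fun ζ => J ζ ^ m) (boundaryMeasure n) := hJm.pow m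
    rw [← integral_sub (hφ.bdd_mul hJm' hb) (hψi.bdd_mul hJm' hb)]
    simp_rw [← mul_sub]
    exact (norm_integral_mul_le_of_norm_eq_one hJ1 hsub.norm
      (ae_of_all _ fun ζ => le_rfl)).trans hψε
  rw [hI.integral_pow_mul_integral_clarkMeasure_of_continuous hJ ψ.continuous, ← dist_eq_norm] at hL
  rw [← dist_eq_norm] at hR
  have := dist_triangle_right (∫ α : UnitCircle, (α : ℂ) ^ m *
    ∫ ζ, φ ζ ∂clarkMeasure I α ∂circleMeasure) (∫ ζ, J ζ ^ m * φ ζ ∂boundaryMeasure n)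
    (∫ ζ, J ζ ^ m * ψ ζ ∂boundaryMeasure n)
  linarith

end Disintegration

/-! ### Uniqueness of Fourier coefficients on the circle. -/

section Fourier

theorem unitCircle_ne_zero (α : UnitCircle) : (α : ℂ) ≠ 0 :=
  norm_ne_zero_iff.1 (by rw [norm_unitCircle]; exact one_ne_zero)

theorem unitCircle_inv_eq_conj (α : UnitCircle) : (α : ℂ)⁻¹ = conj (α : ℂ) := by
  rw [Complex.inv_def, Complex.normSq_eq_norm_sq, norm_unitCircle]
  simp

theorem continuous_unitCircle_zpow (m : ℤ) : Continuous fun α : UnitCircle => (α : ℂ) ^ m :=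
  continuous_subtype_val.zpow₀ m fun α => Or.inl (unitCircle_ne_zero α)

/-- Stone–Weierstrass induction on the multiplier c. Quantifying over all Φ and all m inside the
induction is what lets products pass: the hypothesis for f is applied to g Φ. -/
theorem integral_zpow_mul_continuous_mul_eq_zero {μ : Measure UnitCircle}
    (c : C(UnitCircle, ℂ)) : ∀ Φ : UnitCircle → ℂ, Integrable Φ μ →
      (∀ m : ℤ, ∫ α, (α : ℂ) ^ m * Φ α ∂μ = 0) → ∀ m : ℤ, ∫ α, (α : ℂ) ^ m * (c α * Φ α) ∂μ = 0 := by
  have hbdd : ∀ (f : C(UnitCircle, ℂ)) {Φ : UnitCircle → ℂ}, Integrable Φ μ →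
      Integrable (fun α => f α * Φ α) μ := fun f Φ hΦ =>
    hΦ.bdd_mul f.continuous.aestronglyMeasurable (ae_of_all _ fun α => f.norm_coe_le_norm α)
  have hbddz : ∀ (m : ℤ) {Φ : UnitCircle → ℂ}, Integrable Φ μ →
      Integrable (fun α : UnitCircle => (α : ℂ) ^ m * Φ α) μ := fun m Φ hΦ =>
    hbdd ⟨_, continuous_unitCircle_zpow m⟩ hΦ
  induction c using ContinuousMap.induction_on_of_compact with
  | const r =>
    intro Φ hΦ h m
    simp only [ContinuousMap.const_apply, mul_left_comm _ r, integral_const_mul, h m, mul_zero]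
  | id =>
    intro Φ hΦ h m
    refine Eq.trans ?_ (h (m + 1))
    refine integral_congr_ae (ae_of_all _ fun α => ?_)
    simp [zpow_add₀ (unitCircle_ne_zero α), mul_assoc]
  | star_id =>
    intro Φ hΦ h m
    refine Eq.trans ?_ (h (m - 1))
    refine integral_congr_ae (ae_of_all _ fun α => ?_)
    simp [zpow_sub₀ (unitCircle_ne_zero α), mul_assoc, div_eq_mul_inv, unitCircle_inv_eq_conj]
  | add f g hf hg =>
    intro Φ hΦ h m
    have : ∀ α : UnitCircle, (α : ℂ) ^ m * ((f + g) α * Φ α) =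
        (α : ℂ) ^ m * (f α * Φ α) + (α : ℂ) ^ m * (g α * Φ α) := fun α => by
      rw [ContinuousMap.add_apply]; ring
    simp_rw [this]
    rw [integral_add (hbddz m (hbdd f hΦ)) (hbddz m (hbdd g hΦ)), hf Φ hΦ h, hg Φ hΦ h, add_zero]
  | mul f g hf hg =>
    intro Φ hΦ h m
    simpa [mul_assoc] using hf _ (hbdd g hΦ) (hg Φ hΦ h) m
  | frequently f hf =>
    intro Φ hΦ h m
    refine norm_le_zero_iff.1 (le_of_forall_pos_le_add fun ε hε => ?_)
    set K := ∫ α, ‖Φ α‖ ∂μ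
    have hK : 0 ≤ K := integral_nonneg fun _ => norm_nonneg _
    obtain ⟨g, hgp, hgd⟩ := (hf.and_eventually (Metric.ball_mem_nhds f
      (div_pos hε (by linarith : 0 < K + 1)))).exists
    rw [dist_comm, dist_eq_norm] at hgd
    have h1 : ∫ α, (α : ℂ) ^ m * (f α * Φ α) ∂μ = ∫ α, (α : ℂ) ^ m * ((f - g) α * Φ α) ∂μ := by
      have : ∀ α : UnitCircle, (α : ℂ) ^ m * ((f - g) α * Φ α) =
          (α : ℂ) ^ m * (f α * Φ α) - (α : ℂ) ^ m * (g α * Φ α) := fun α => by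
        rw [ContinuousMap.sub_apply]; ring
      simp_rw [this]
      rw [integral_sub (hbddz m (hbdd f hΦ)) (hbddz m (hbdd g hΦ)), hgp Φ hΦ h, sub_zero]
    rw [h1, zero_add]
    refine (norm_integral_le_of_norm_le (hΦ.norm.const_mul ‖f - g‖)
      (ae_of_all _ fun α => ?_)).trans ?_
    · rw [norm_mul, norm_zpow, norm_unitCircle, one_zpow, one_mul, norm_mul]
      gcongr
      exact (f - g).norm_coe_le_norm α
    · rw [integral_const_mul]
      rw [lt_div_iff₀ (by linarith)] at hgd
      nlinarith [norm_nonneg (f - g)]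

/-- An integrable function on the circle with vanishing Fourier coefficients vanishes. -/
theorem ae_eq_zero_of_integral_zpow_mul_eq_zero {μ : Measure UnitCircle} {Φ : UnitCircle → ℂ}
    (hΦ : Integrable Φ μ) (h : ∀ m : ℤ, ∫ α, (α : ℂ) ^ m * Φ α ∂μ = 0) : Φ =ᵐ[μ] 0 := by
  -- Integrals over closed sets suffice, and these are limits of integrals against continuous
  -- functions, which vanish by the preceding lemma with exponent 0.
  refine ae_eq_zero_of_forall_setIntegral_isClosed_eq_zero hΦ fun F hF => ?_
  have hz : ∀ m : ℕ, ∫ α, ((hF.apprSeq m α : ℝ) : ℂ) * Φ α ∂μ = 0 := by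
    intro m
    have := integral_zpow_mul_continuous_mul_eq_zero
      ⟨fun α => ((hF.apprSeq m α : ℝ) : ℂ), by fun_prop⟩ Φ hΦ h 0
    simp only [zpow_zero, one_mul] at this
    exact this
  rw [← integral_indicator hF.measurableSet]
  refine tendsto_nhds_unique (f := fun m : ℕ => ∫ α, ((hF.apprSeq m α : ℝ) : ℂ) * Φ α ∂μ) (l := atTop)
    (tendsto_integral_of_dominated_convergence (fun α => ‖Φ α‖) (fun m => ?_) hΦ.norm
      (fun m => ae_of_all _ fun α => ?_) (ae_of_all _ fun α => ?_)) ?_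
  · exact (Continuous.aestronglyMeasurable (by fun_prop)).mul hΦ.aestronglyMeasurable
  · rw [norm_mul]
    refine mul_le_of_le_one_left (norm_nonneg _) ?_
    have := HasOuterApproxClosed.apprSeq_apply_le_one hF m α
    simpa using this
  · have h1 := tendsto_pi_nhds.1 (HasOuterApproxClosed.tendsto_apprSeq hF) α
    have h2 : Tendsto (fun m => ((hF.apprSeq m α : ℝ) : ℂ) * Φ α) atTop
        (𝓝 ((((F.indicator (fun _ => (1 : NNReal)) α : NNReal) : ℝ) : ℂ) * Φ α)) :=
      (((Complex.continuous_ofReal.comp NNReal.continuous_coe).tendsto _).comp h1).mul_const _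
    convert! h2 using 2
    by_cases hα : α ∈ F <;> simp [hα]
  · simp [hz]

theorem integral_unitCircle_pow (m : ℕ) :
    ∫ α : UnitCircle, (α : ℂ) ^ (m + 1) ∂circleMeasure = 0 := by
  have := integral_circle_pow_mul_herglotz (w := 0) (by simp) (m + 1)
  simpa [herglotz_eq_div] using this

end Fourier

/-! ### Vanishing of the Fourier coefficients for the large model space. -/

section ModelSpace

variable {k : ℕ} {n : Fin k → ℕ} {I : Ambient n → ℂ}

theorem IsInner.pow_mul_mem_hardySpace (hI : IsInner I) {f : Ambient n → ℂ} (hf : f ∈ hardySpace n)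
    (m : ℕ) : (fun z => I z ^ m * f z) ∈ hardySpace n := by
  refine ⟨(hI.holomorphic.fun_pow m).fun_mul hf.1, lt_of_le_of_lt (iSup₂_mono fun r hr => ?_) hf.2⟩
  refine lintegral_mono fun ζ => ?_
  gcongr
  rw [enorm_mul]
  refine mul_le_of_le_one_left' ?_
  rw [enorm_pow]
  refine pow_le_one' ?_ _
  rw [← ofReal_norm, ENNReal.ofReal_le_one]
  exact (hI.norm_lt_one _ (mem_domain_dilate hr ζ)).le

variable {J : DistBoundary n → ℂ}

/-- `J^{m+1} f` is orthogonal to `g` if `f` is in the Hardy space and `g` is orthogonal to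
`I H²`. -/
theorem IsInner.integral_pow_mul_conj_eq_zero (hI : IsInner I)
    (hJm : AEStronglyMeasurable J (boundaryMeasure n))
    (hJ : ∀ᵐ ζ ∂boundaryMeasure n, HasRadialLimit I ζ (J ζ) ∧ ‖J ζ‖ = 1)
    {f g : Lp ℂ 2 (boundaryMeasure n)} (hf : f ∈ boundaryValues (hardySpace n))
    (hg : g ∈ (boundaryValues (innerMulHardySpace I))ᗮ) (m : ℕ) :
    ∫ ζ, J ζ ^ (m + 1) * (f ζ * conj (g ζ)) ∂boundaryMeasure n = 0 := by
  obtain ⟨f₀, hf₀, hf₀f⟩ := hf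
  have hmem : MemLp (fun ζ => J ζ ^ (m + 1) * f ζ) 2 (boundaryMeasure n) := by
    refine (Lp.memLp f).of_le ((hJm.pow (m + 1)).mul (Lp.aestronglyMeasurable f)) ?_
    filter_upwards [hJ] with ζ h
    simp [h.2]
  -- J^(m+1) f is the boundary value of I · (I^m f₀), and I^m f₀ stays in the Hardy space because
  -- |I| < 1.
  have hu : hmem.toLp _ ∈ boundaryValues (innerMulHardySpace I) := by
    refine ⟨fun z => I z * (I z ^ m * f₀ z), ⟨_, hI.pow_mul_mem_hardySpace hf₀ m, rfl⟩, ?_⟩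
    filter_upwards [hJ, hf₀f, hmem.coeFn_toLp] with ζ h1 h2 h3
    rw [h3, pow_succ', mul_assoc]
    exact Tendsto.mul h1.1 (Tendsto.mul (h1.1.pow m) h2)
  have h := (Submodule.mem_orthogonal' _ _).1 hg _ hu
  rw [L2.inner_def] at h
  rw [← h]
  refine integral_congr_ae ?_
  filter_upwards [hmem.coeFn_toLp] with ζ h1
  rw [h1, RCLike.inner_apply]
  ring

theorem integral_mul_conj_eq_inner (f g : Lp ℂ 2 (boundaryMeasure n)) :
    ∫ ζ, f ζ * conj (g ζ) ∂boundaryMeasure n = inner ℂ g f := by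
  rw [L2.inner_def]
  simp only [RCLike.inner_apply]

theorem integrable_mul_conj (f g : Lp ℂ 2 (boundaryMeasure n)) :
    Integrable (fun ζ => f ζ * conj (g ζ)) (boundaryMeasure n) := by
  have := L2.integrable_inner (𝕜 := ℂ) g f
  simpa only [RCLike.inner_apply] using this

variable [∀ j, NeZero (n j)]

/-- The integrals of `f ḡ` with respect to the Clark measures do not depend on the measure. -/
theorem IsInner.ae_inner_eq_integral_clarkMeasure (hI : IsInner I)
    {f g : Lp ℂ 2 (boundaryMeasure n)} (hf : f ∈ largeModelSpace I) (hg : g ∈ largeModelSpace I) :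
    ∀ᵐ α ∂circleMeasure, ∫ ζ, f ζ * conj (g ζ) ∂clarkMeasure I α = inner ℂ g f := by
  obtain ⟨J, hJm, hJ⟩ := hI.exists_boundary_function
  set Φ : UnitCircle → ℂ := fun α => ∫ ζ, f ζ * conj (g ζ) ∂clarkMeasure I α with hΦ
  set c : ℂ := inner ℂ g f with hc
  have hΦi : Integrable Φ circleMeasure := hI.integrable_integral_clarkMeasure (integrable_mul_conj f g)
  have hpos : ∀ m : ℕ, ∫ α : UnitCircle, (α : ℂ) ^ (m + 1) * Φ α ∂circleMeasure = 0 := fun m => by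
    rw [hI.integral_pow_mul_integral_clarkMeasure hJm hJ (integrable_mul_conj f g)]
    exact hI.integral_pow_mul_conj_eq_zero hJm hJ hf.1 hg.2 m
  -- Negative frequencies are the conjugates of positive ones with f and g exchanged; here f is
  -- orthogonal to I H² and g is in the Hardy space.
  have hneg : ∀ m : ℕ, ∫ α : UnitCircle, conj (α : ℂ) ^ (m + 1) * Φ α ∂circleMeasure = 0 := by
    intro m
    have h1 := hI.integral_pow_mul_integral_clarkMeasure hJm hJ (integrable_mul_conj g f) (m + 1)
    rw [hI.integral_pow_mul_conj_eq_zero hJm hJ hg.1 hf.2 m] at h1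
    have h2 := congrArg (starRingEnd ℂ) h1
    rw [map_zero, ← integral_conj] at h2
    refine Eq.trans ?_ h2
    refine integral_congr_ae (ae_of_all _ fun α => ?_)
    simp only [hΦ, map_mul, map_pow, ← integral_conj, Complex.conj_conj]
    congr 2 with ζ
    ring
  have h0 : ∫ α, Φ α ∂circleMeasure = c := by
    rw [hΦ, hI.integral_integral_clarkMeasure (integrable_mul_conj f g), integral_mul_conj_eq_inner]
  have hzi : ∀ m : ℤ, Integrable (fun α : UnitCircle => (α : ℂ) ^ m) circleMeasure := fun m =>
    integrable_of_continuous_of_compactSpace (continuous_unitCircle_zpow m)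
  have hzΦ : ∀ m : ℤ, Integrable (fun α : UnitCircle => (α : ℂ) ^ m * Φ α) circleMeasure := fun m =>
    hΦi.bdd_mul (c := 1) (hzi m).aestronglyMeasurable (ae_of_all _ fun α => by
      rw [norm_zpow, norm_unitCircle, one_zpow])
  have hzero : (fun α => Φ α - c) =ᵐ[circleMeasure] 0 := by
    refine ae_eq_zero_of_integral_zpow_mul_eq_zero (hΦi.sub (integrable_const c)) fun m => ?_
    simp_rw [mul_sub]
    rw [integral_sub (hzΦ m) ((hzi m).mul_const c), integral_mul_const]
    -- The zero frequency occurs in both sign cases; there c is subtracted from the mean of Φ, which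
    -- is c.
    obtain ⟨m, rfl | rfl⟩ := m.eq_nat_or_neg <;> rcases m with _ | m
    · simp [h0]
    · simp only [zpow_natCast, hpos, integral_unitCircle_pow, zero_mul, sub_zero]
    · simp [h0]
    · have h2 : ∀ α : UnitCircle, (α : ℂ) ^ (-((m + 1 : ℕ) : ℤ)) = conj (α : ℂ) ^ (m + 1) := by
        intro α
        rw [zpow_neg, zpow_natCast, ← inv_pow, unitCircle_inv_eq_conj]
      have h3 : ∫ α : UnitCircle, conj (α : ℂ) ^ (m + 1) ∂circleMeasure = 0 := by
        simp_rw [← map_pow]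
        rw [integral_conj, integral_unitCircle_pow, map_zero]
      simp only [h2, hneg, h3, zero_mul, sub_zero]
  filter_upwards [hzero] with α h
  exact sub_eq_zero.1 h

end ModelSpace

end ModelSpaces

end

/-! ### The theorem for arbitrary representatives. -/

theorem mainTheorem3 {k : ℕ} (hk : 1 ≤ k) (n : Fin k → ℕ) (hn : ∀ j, 1 ≤ n j)
    (I : ModelSpaces.Ambient n → ℂ) (hI : ModelSpaces.IsInner I) :
    (∀ α : ModelSpaces.UnitCircle,
      ∃! σ : Measure (ModelSpaces.DistBoundary n), ModelSpaces.IsClarkMeasure I α σ) ∧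
    ∀ f ∈ ModelSpaces.largeModelSpace I, ∀ g ∈ ModelSpaces.largeModelSpace I,
      -- arbitrary representatives of the classes `f` and `g` of `Σ`-almost everywhere equal functions
      ∀ F G : ModelSpaces.DistBoundary n → ℂ,
        F =ᵐ[ModelSpaces.boundaryMeasure n] f → G =ᵐ[ModelSpaces.boundaryMeasure n] g →
        ∀ᵐ α ∂ModelSpaces.circleMeasure,
          Integrable (fun ζ => F ζ * conj (G ζ)) (ModelSpaces.clarkMeasure I α) ∧
          -- Mathlib's `inner ℂ g f` is linear in `f`: it is `(f, g)_{H²}`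
          inner ℂ g f = ∫ ζ, F ζ * conj (G ζ) ∂ModelSpaces.clarkMeasure I α := by
  have : ∀ j, NeZero (n j) := fun j => ⟨Nat.one_le_iff_ne_zero.1 (hn j)⟩
  refine ⟨fun α => ⟨_, hI.isClarkMeasure_clarkMeasure α,
    fun σ hσ => hσ.unique (hI.isClarkMeasure_clarkMeasure α)⟩, fun f hf g hg F G hF hG => ?_⟩
  -- The products agree off a Σ-null set, which the disintegration makes σ_α-null for almost every
  -- α.
  have hFG : (fun ζ => F ζ * conj (G ζ)) =ᵐ[ModelSpaces.boundaryMeasure n]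
      fun ζ => f ζ * conj (g ζ) := by
    filter_upwards [hF, hG] with ζ h1 h2
    rw [h1, h2]
  filter_upwards [hI.ae_inner_eq_integral_clarkMeasure hf hg, hI.ae_ae_clarkMeasure hFG,
    hI.ae_integrable_clarkMeasure (ModelSpaces.integrable_mul_conj f g)] with α h1 h2 h3
  refine ⟨h3.congr ?_, ?_⟩
  · filter_upwards [h2] with ζ h
    exact h.symm
  · rw [← h1]
    refine integral_congr_ae ?_
    filter_upwards [h2] with ζ h
    exact h.symm
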